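/- Let $\mathbb{R}^{2n}$ carry coordinates $(p,q)$, the Euclidean inner product, the symplectic form $\omega=\sum_{i=1}^n dp_i\wedge dq_i$ and the complex structure $J(p,q)=(-q,p)$, so that $\langle Jv,w\rangle=\omega(v,w)$. Let $K\subset\mathbb{R}^{2n}$ be a compact convex set with $0\in\operatorname{int}K$, not necessarily smooth. For $x\in\partial K$ let $N_K(x)=\{v:\langle v,x-y\rangle\ge 0\ \forall y\in K\}$ be the normal cone, and let $h_K(v)=\sup_{x\in K}\langle x,v\rangle$ be the support function. A closed characteristic on $\partial K$ is a nonconstant absolutely continuous curve $\gamma:[0,T]\to\partial K$, $T>0$, with $\gamma(0)=\gamma(T)$ and $\dot\gamma\in L^2$, such that $-J\dot\gamma(t)\in N_K(\gamma(t))$ for almost every $t$. Its action is $\mathcal{A}(\gamma)=\frac12\int_0^T\omega(\gamma,\dot\gamma)\,dt=\frac12\int_\gamma\sum_i (p_i\,dq_i-q_i\,dp_i)$, and $c_{\mathrm{EHZ}}(K)$ is the minimal action of a closed characteristic on $\partial K$. Let $\mathrm{Sys}(K)$ be the set of closed characteristics $\gamma$ of action $c_{\mathrm{EHZ}}(K)$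 that are normalized by $h_K(-J\dot\gamma(t))=2$ for almost every $t$; under this normalization the period equals the action, so they are parametrized by $[0,c_{\mathrm{EHZ}}(K)]$ (by $[0,1]$, that is by $S^1=\mathbb{R}/\mathbb{Z}$, if $K$ is scaled so that $c_{\mathrm{EHZ}}(K)=1$). Theorem. Let $\gamma\in\mathrm{Sys}(K)$. Then for almost every $t\in[0,c_{\mathrm{EHZ}}(K)]$ the following holds: whenever $\dot\gamma(t)=\sum_{i=1}^k a_i w_i$ with $k\in\mathbb{N}$, coefficients $a_i>0$ and $w_i\in J N_K(\gamma(t))$ (in particular, whenever $\dot\gamma(t)$ is a convex combination of $w_1,\dots,w_k\in JN_K(\gamma(t))$ with all coefficients nonzero), one has $\omega(w_i,w_j)=0$ for all $i,j$. -/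

import Mathlib

open MeasureTheory Set

noncomputable section

namespace CharDyn

/-- The phase space `ℝ²ⁿ` with its Euclidean structure. The coordinate `Sum.inl i` is `pᵢ`
and the coordinate `Sum.inr i` is `qᵢ`. -/
abbrev PhaseSpace (n : ℕ) : Type := EuclideanSpace ℝ (Fin n ⊕ Fin n)

/-- The standard symplectic form `ω = ∑ᵢ dpᵢ ∧ dqᵢ`. -/
def omega {n : ℕ} (v w : PhaseSpace n) : ℝ :=
  ∑ i : Fin n, (v (Sum.inl i) * w (Sum.inr i) - v (Sum.inr i) * w (Sum.inl i))

/-- The standard complex structure `J (p, q) = (-q, p)`; it satisfies `⟪J v, w⟫ = ω(v, w)`. -/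
def J {n : ℕ} : PhaseSpace n →ₗ[ℝ] PhaseSpace n :=
  Matrix.toEuclideanLin (Matrix.J (Fin n) ℝ)

theorem J_inl {n : ℕ} (v : PhaseSpace n) (i : Fin n) : J v (Sum.inl i) = - v (Sum.inr i) := by
  simp [J, Matrix.J, Matrix.toLpLin_apply, Matrix.fromBlocks_mulVec, Matrix.neg_mulVec]

theorem J_inr {n : ℕ} (v : PhaseSpace n) (i : Fin n) : J v (Sum.inr i) = v (Sum.inl i) := by
  simp [J, Matrix.J, Matrix.toLpLin_apply, Matrix.fromBlocks_mulVec]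

theorem inner_J {n : ℕ} (v w : PhaseSpace n) : inner ℝ (J v) w = omega v w := by
  simp only [PiLp.inner_apply, Fintype.sum_sum_type, J_inl, J_inr, omega, Finset.sum_sub_distrib]
  simp [mul_comm]
  ring

/-- The normal cone `N_K(x) = {v : ⟪v, x - y⟫ ≥ 0 for all y ∈ K}`. -/
def normalCone {n : ℕ} (K : Set (PhaseSpace n)) (x : PhaseSpace n) : Set (PhaseSpace n) :=
  {v | ∀ y ∈ K, 0 ≤ inner ℝ v (x - y)}

/-- The support function `h_K(v) = sup {⟪x, v⟫ : x ∈ K}`. -/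
def supportFn {n : ℕ} (K : Set (PhaseSpace n)) (v : PhaseSpace n) : ℝ :=
  sSup ((fun x : PhaseSpace n => inner ℝ x v) '' K)

/-- `γ`, restricted to `[0, T]`, is a nonconstant closed (generalized) characteristic on `∂K`:
a loop of class `W^{1,2}([0, T], ∂K)`, that is, absolutely continuous with square-integrable
derivative, with `-J γ'(t) ∈ N_K(γ(t))` for almost every `t`. -/
structure IsClosedCharacteristic {n : ℕ} (K : Set (PhaseSpace n)) (T : ℝ)
    (γ : ℝ → PhaseSpace n) : Prop where
  period_pos : 0 < T
  absolutelyContinuous : AbsolutelyContinuousOnInterval γ 0 T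
  memLp_deriv : MemLp (deriv γ) 2 (volume.restrict (Icc 0 T))
  mem_boundary : ∀ t ∈ Icc 0 T, γ t ∈ frontier K
  closed : γ 0 = γ T
  deriv_mem : ∀ᵐ t ∂(volume.restrict (Icc 0 T)), -J (deriv γ t) ∈ normalCone K (γ t)
  nonconstant : ∃ t ∈ Icc 0 T, γ t ≠ γ 0

/-- The action `½ ∫ ∑ᵢ (pᵢ dqᵢ - qᵢ dpᵢ)` of a loop parametrized by `[0, T]`. -/
def action {n : ℕ} (T : ℝ) (γ : ℝ → PhaseSpace n) : ℝ :=
  (1 / 2) * ∫ t in (0 : ℝ)..T, omega (γ t) (deriv γ t)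

/-- The Ekeland–Hofer–Zehnder capacity of a convex body: the minimal action of a
closed characteristic on its boundary. -/
def cEHZ {n : ℕ} (K : Set (PhaseSpace n)) : ℝ :=
  sInf {A : ℝ | ∃ (T : ℝ) (γ : ℝ → PhaseSpace n), IsClosedCharacteristic K T γ ∧ action T γ = A}

/-- The action-minimizing closed characteristics, normalized by `h_K(-J γ') = 2`.
Under this normalization the period equals the action, so `γ` is parametrized by
`[0, cEHZ K]`; this is `[0, 1]` when `cEHZ K = 1`. -/
def Sys {n : ℕ} (K : Set (PhaseSpace n)) : Set (ℝ → PhaseSpace n) :=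
  {γ | IsClosedCharacteristic K (cEHZ K) γ ∧ action (cEHZ K) γ = cEHZ K ∧
    ∀ᵐ t ∂(volume.restrict (Icc 0 (cEHZ K))), supportFn K (-J (deriv γ t)) = 2}

end CharDyn

end

/-! ### Linear symplectic algebra. -/

namespace CharDyn

open Filter Topology

variable {n : ℕ}

/-! Write `charLength K w` for $h_K(-Jw)$. Clarke duality gives `two_mul_cEHZ_mul_area_le`, an
isoperimetric inequality for loops of any period $T$; for $T=c_{\mathrm{EHZ}}(K)$ it bounds twice
the `area` of a closed velocity field $x$ by $\int h_K(-Jx)^2$. A curve in `Sys K` has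
$h_K(-J\dot\gamma)=2$ and `area` $2T$, so it is an equality case, and no perturbation of its
velocity may gain area without paying in length.

Suppose $\dot\gamma(t)=\sum a_lw_l$ with $\omega(w_i,w_j)>0$. On the cone spanned by the $w_l$, the
function $h_K(-J\,\cdot)$ agrees with the linear form $\omega(\gamma(t),\cdot)$. Subtracting
multiples of $\dot\gamma$ from small multiples of $w_i,w_j$ gives $u,v$ in the kernel of this form.
Replacing $\dot\gamma$ by $\dot\gamma+au+bv$ with $|a|,|b|\le1$ then costs no length and does not
change the area to first order. Moreover $\omega(u,v)>0$, since $\omega(\dot\gamma,w_l)=0$ at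
differentiability times (`omega_eq_zero_of_hasDerivAt`, `exists_flat_pair`). A small loop inserted
in the plane of $u,v$ gains area to second order, against the inequality.

The pair $(u,v)$ is tied to one time $t$, while a loop needs an interval. So flatness is relaxed to
an open condition with error $\theta$ (`almostFlat`). Countably many balls of pairs suffice, almost
every bad time is a density point of the set belonging to one of them, and the directions are
selected measurably near the centre of that ball. Closing the perturbed loop is a finite-dimensional
linear condition, met by a polynomial profile whose gain has a uniform lower bound
(`exists_profile`). The gain is at least a fixed multiple of the squared interval length, while the
cost is $O(\theta)$ with $\theta\to0$ on the same interval (`not_dense_almostFlat`).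

The inequality itself follows from the direct method. The area is weakly continuous, so a maximizer
exists (`exists_isoperimetric_maximizer`). A Hahn–Banach multiplier (`exists_lagrange_multiplier`)
translates its primitive, and after rescaling this is a closed characteristic whose action is
computed from the maximal area. -/

theorem J_J (v : PhaseSpace n) : J (J v) = -v := by
  ext i
  rcases i with i | i <;> simp [J_inl, J_inr]

theorem omega_self (v : PhaseSpace n) : omega v v = 0 := by
  simp [omega, mul_comm]

theorem omega_swap (v w : PhaseSpace n) : omega w v = -omega v w := by
  simp only [omega, ← Finset.sum_neg_distrib]
  exact Finset.sum_congr rfl fun i _ => by ring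

/-- The symplectic form as a continuous bilinear map. -/
noncomputable def omegaL : PhaseSpace n →L[ℝ] PhaseSpace n →L[ℝ] ℝ :=
  (innerSL ℝ).comp (LinearMap.toContinuousLinearMap (J (n := n)))

@[simp] theorem omegaL_apply (v w : PhaseSpace n) : omegaL v w = omega v w := by
  simp [omegaL, inner_J]

theorem inner_neg_J (v w : PhaseSpace n) : inner ℝ v (-J w) = omega v w := by
  rw [inner_neg_right, real_inner_comm, inner_J, omega_swap, neg_neg]

theorem omega_add_left (u v w : PhaseSpace n) : omega (u + v) w = omega u w + omega v w := by
  simp [← omegaL_apply]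

theorem omega_add_right (u v w : PhaseSpace n) : omega u (v + w) = omega u v + omega u w := by
  simp [← omegaL_apply]

theorem omega_sub_left (u v w : PhaseSpace n) : omega (u - v) w = omega u w - omega v w := by
  simp [← omegaL_apply]

theorem omega_sub_right (u v w : PhaseSpace n) : omega u (v - w) = omega u v - omega u w := by
  simp [← omegaL_apply]

theorem omega_smul_left (a : ℝ) (v w : PhaseSpace n) : omega (a • v) w = a * omega v w := by
  simp [← omegaL_apply]

theorem omega_smul_right (a : ℝ) (v w : PhaseSpace n) : omega v (a • w) = a * omega v w := by
  simp [← omegaL_apply]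

theorem omega_zero_left (w : PhaseSpace n) : omega 0 w = 0 := by
  simp [← omegaL_apply]

theorem omega_zero_right (w : PhaseSpace n) : omega w 0 = 0 := by
  simp [← omegaL_apply]

theorem norm_J (v : PhaseSpace n) : ‖J v‖ = ‖v‖ := by
  have h : inner ℝ (J v) (J v) = inner ℝ v v := by
    rw [inner_J, omega_swap, ← inner_J, J_J, inner_neg_left, neg_neg]
  rw [real_inner_self_eq_norm_sq, real_inner_self_eq_norm_sq] at h
  exact (sq_eq_sq₀ (norm_nonneg _) (norm_nonneg _)).1 h

theorem abs_omega_le (v w : PhaseSpace n) : |omega v w| ≤ ‖v‖ * ‖w‖ := by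
  rw [← inner_J, ← norm_J v]
  exact abs_real_inner_le_norm _ _

theorem continuous_omega : Continuous fun z : PhaseSpace n × PhaseSpace n => omega z.1 z.2 := by
  simp only [← omegaL_apply]
  fun_prop

theorem _root_.Continuous.omega {X : Type*} [TopologicalSpace X] {f g : X → PhaseSpace n}
    (hf : Continuous f) (hg : Continuous g) : Continuous fun x => CharDyn.omega (f x) (g x) :=
  continuous_omega.comp (hf.prodMk hg)

theorem eq_of_forall_omega_eq {v w : PhaseSpace n} (h : ∀ u, omega v u = omega w u) : v = w := by
  have : J v = J w := ext_inner_right ℝ fun u => by rw [inner_J, inner_J, h]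
  have h2 := congrArg J this
  rwa [J_J, J_J, neg_inj] at h2

/-- The support function composed with `-J`: `charLength K w = sup {ω(k, w) : k ∈ K}`. -/
noncomputable def charLength (K : Set (PhaseSpace n)) (w : PhaseSpace n) : ℝ :=
  supportFn K (-J w)

/-! ### The support function, the gauge and the normal cone. -/

section Body

variable {K : Set (PhaseSpace n)}

theorem charLength_eq (w : PhaseSpace n) :
    charLength K w = sSup ((fun k => omega k w) '' K) := by
  simp only [charLength, supportFn, inner_neg_J]

theorem isCompact_omega_image (hcomp : IsCompact K) (w : PhaseSpace n) :
    IsCompact ((fun k => omega k w) '' K) :=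
  hcomp.image (continuous_id.omega continuous_const)

theorem omega_le_charLength (hcomp : IsCompact K) {k : PhaseSpace n} (hk : k ∈ K)
    (w : PhaseSpace n) : omega k w ≤ charLength K w := by
  rw [charLength_eq]
  exact le_csSup (isCompact_omega_image hcomp w).bddAbove ⟨k, hk, rfl⟩

theorem exists_charLength_eq (hcomp : IsCompact K) (hne : K.Nonempty) (w : PhaseSpace n) :
    ∃ k ∈ K, charLength K w = omega k w := by
  obtain ⟨k, hk, h⟩ := (isCompact_omega_image hcomp w).sSup_mem (hne.image _)
  exact ⟨k, hk, by rw [charLength_eq]; exact h.symm⟩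

theorem charLength_le (hcomp : IsCompact K) (hne : K.Nonempty) {w : PhaseSpace n} {a : ℝ}
    (h : ∀ k ∈ K, omega k w ≤ a) : charLength K w ≤ a := by
  obtain ⟨k, hk, h'⟩ := exists_charLength_eq hcomp hne w
  rw [h']
  exact h k hk

theorem charLength_add_le (hcomp : IsCompact K) (hne : K.Nonempty) (v w : PhaseSpace n) :
    charLength K (v + w) ≤ charLength K v + charLength K w :=
  charLength_le hcomp hne fun k hk => by
    rw [omega_add_right]
    exact add_le_add (omega_le_charLength hcomp hk v) (omega_le_charLength hcomp hk w)

theorem charLength_smul (hcomp : IsCompact K) (hne : K.Nonempty) {a : ℝ} (ha : 0 ≤ a)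
    (w : PhaseSpace n) : charLength K (a • w) = a * charLength K w := by
  apply le_antisymm
  · refine charLength_le hcomp hne fun k hk => ?_
    rw [omega_smul_right]
    exact mul_le_mul_of_nonneg_left (omega_le_charLength hcomp hk w) ha
  · obtain ⟨k, hk, h⟩ := exists_charLength_eq hcomp hne w
    rw [h, ← omega_smul_right]
    exact omega_le_charLength hcomp hk _

theorem charLength_nonneg (hcomp : IsCompact K) (h0 : (0 : PhaseSpace n) ∈ K)
    (w : PhaseSpace n) : 0 ≤ charLength K w := by
  simpa [omega_zero_left] using omega_le_charLength hcomp h0 w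

theorem charLength_zero (hcomp : IsCompact K) (hne : K.Nonempty) :
    charLength K (0 : PhaseSpace n) = 0 := by
  simpa using charLength_smul hcomp hne le_rfl (0 : PhaseSpace n)

theorem exists_charLength_lipschitz (hcomp : IsCompact K) (hne : K.Nonempty) :
    ∃ R : NNReal, LipschitzWith R (charLength K) := by
  obtain ⟨R, hR⟩ := hcomp.isBounded.exists_norm_le
  refine ⟨R.toNNReal, LipschitzWith.of_le_add_mul _ fun v w => ?_⟩
  refine charLength_le hcomp hne fun k hk => ?_
  have h1 := omega_le_charLength hcomp hk w
  have h2 : omega k (v - w) ≤ R.toNNReal * dist v w := by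
    rw [dist_eq_norm]
    refine (le_abs_self _).trans ((abs_omega_le _ _).trans ?_)
    exact mul_le_mul_of_nonneg_right ((hR k hk).trans (Real.le_coe_toNNReal R)) (norm_nonneg _)
  rw [omega_sub_right] at h2
  linarith

theorem continuous_charLength (hcomp : IsCompact K) (hne : K.Nonempty) :
    Continuous (charLength K) :=
  (exists_charLength_lipschitz hcomp hne).choose_spec.continuous

/-- A ball of radius $r$ about $0$ lies in $K$; test the supremum on the multiple of $-Jw$ of norm
$r/2$, using $\omega(-Jw,w)=\|w\|^2$. -/
theorem exists_mul_norm_le_charLength (hcomp : IsCompact K)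
    (h0 : (0 : PhaseSpace n) ∈ interior K) :
    ∃ r > 0, ∀ w, r * ‖w‖ ≤ charLength K w := by
  obtain ⟨r, hr, hrK⟩ := Metric.mem_nhds_iff.1 (mem_interior_iff_mem_nhds.1 h0)
  refine ⟨r / 2, by positivity, fun w => ?_⟩
  rcases eq_or_ne w 0 with rfl | hw
  · rw [norm_zero, mul_zero]
    exact charLength_nonneg hcomp (interior_subset h0) _
  have hw' : 0 < ‖w‖ := norm_pos_iff.2 hw
  have hk : (-(r / 2 / ‖w‖)) • J w ∈ K := by
    apply hrK
    rw [mem_ball_zero_iff, norm_smul, norm_J, norm_neg, Real.norm_of_nonneg (by positivity)]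
    field_simp
    linarith
  have h := omega_le_charLength hcomp hk w
  rw [omega_smul_left, ← inner_J, J_J, inner_neg_left, real_inner_self_eq_norm_sq] at h
  calc r / 2 * ‖w‖ = -(r / 2 / ‖w‖) * -‖w‖ ^ 2 := by field_simp
    _ ≤ _ := h

/-- Hahn–Banach separation: every linear functional has the form $\omega(\cdot,w)$. -/
theorem mem_of_forall_omega_le (hconv : Convex ℝ K) (hcomp : IsCompact K) (hne : K.Nonempty)
    {z : PhaseSpace n} (h : ∀ w, omega z w ≤ charLength K w) : z ∈ K := by
  by_contra hz
  obtain ⟨f, u, h1, h2⟩ := geometric_hahn_banach_closed_point hconv hcomp.isClosed hz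
  obtain ⟨w, hw⟩ : ∃ w, ∀ k, f k = omega k w := by
    refine ⟨J ((InnerProductSpace.toDual ℝ _).symm f), fun k => ?_⟩
    rw [← inner_neg_J, J_J, neg_neg, real_inner_comm, InnerProductSpace.toDual_symm_apply]
  have h3 : charLength K w ≤ u := charLength_le hcomp hne fun k hk => by
    rw [← hw]; exact (h1 k hk).le
  have := h w
  rw [← hw] at this
  linarith

theorem omega_le_gauge_mul_charLength (hconv : Convex ℝ K) (hcomp : IsCompact K)
    (h0 : (0 : PhaseSpace n) ∈ interior K) (z w : PhaseSpace n) :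
    omega z w ≤ gauge K z * charLength K w := by
  have hnhds := mem_interior_iff_mem_nhds.1 h0
  refine le_of_forall_pos_le_add fun ε hε => ?_
  -- The gauge may vanish, so it is enlarged by `δ` before dividing; the resulting error is `δ *
  -- charLength K w ≤ ε`.
  set δ := ε / (charLength K w + 1) with hδ
  have he := charLength_nonneg hcomp (interior_subset h0) w
  have hδ0 : 0 < δ := by positivity
  have hg : 0 < gauge K z + δ := add_pos_of_nonneg_of_pos (gauge_nonneg _) hδ0
  have hmem : (gauge K z + δ)⁻¹ • z ∈ K := by
    have : gauge K ((gauge K z + δ)⁻¹ • z) ≤ 1 := by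
      rw [gauge_smul_of_nonneg (inv_nonneg.2 hg.le), smul_eq_mul, inv_mul_le_one₀ hg]
      linarith
    have := (gauge_le_one_iff_mem_closure hconv hnhds).1 this
    rwa [hcomp.isClosed.closure_eq] at this
  have h := omega_le_charLength hcomp hmem w
  rw [omega_smul_left, inv_mul_le_iff₀ hg] at h
  have h2 : δ * charLength K w ≤ ε := by
    rw [hδ, div_mul_eq_mul_div, div_le_iff₀ (by positivity)]
    nlinarith
  nlinarith

theorem gauge_le_of_forall_omega_le (hconv : Convex ℝ K) (hcomp : IsCompact K)
    (h0 : (0 : PhaseSpace n) ∈ interior K) {z : PhaseSpace n} {ρ : ℝ} (hρ : 0 ≤ ρ)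
    (h : ∀ w, omega z w ≤ ρ * charLength K w) : gauge K z ≤ ρ := by
  have hne : K.Nonempty := ⟨0, interior_subset h0⟩
  rcases hρ.eq_or_lt with rfl | hρ
  · have : z = 0 := by
      refine eq_of_forall_omega_eq fun w => ?_
      have h1 := h w
      have h2 := h (-w)
      rw [← neg_one_smul ℝ w, omega_smul_right] at h2
      rw [omega_zero_left]
      linarith
    simp [this]
  · refine gauge_le_of_mem hρ.le ?_
    rw [mem_smul_set_iff_inv_smul_mem₀ hρ.ne']
    refine mem_of_forall_omega_le hconv hcomp hne fun w => ?_
    rw [omega_smul_left, inv_mul_le_iff₀ hρ]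
    exact h w

/-- Normality means that $z$ maximizes $\omega(\cdot,w)$ over $K$. All later arguments use the
normal cone in this form. -/
theorem neg_J_mem_normalCone_iff (hcomp : IsCompact K) (hne : K.Nonempty) (z w : PhaseSpace n) :
    -J w ∈ normalCone K z ↔ charLength K w ≤ omega z w := by
  have key : ∀ y, (0 : ℝ) ≤ inner ℝ (-J w) (z - y) ↔ omega y w ≤ omega z w := fun y => by
    rw [real_inner_comm, inner_neg_J, omega_sub_left, sub_nonneg]
  constructor
  · exact fun h => charLength_le hcomp hne fun k hk => (key k).1 (h k hk)
  · exact fun h k hk => (key k).2 ((omega_le_charLength hcomp hk w).trans h)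

end Body

end CharDyn

/-! ### The symplectic area as a bilinear form on velocity fields. -/

namespace CharDyn

open Filter Topology

variable {n : ℕ}

/-- The primitive of `x` vanishing at `0`. -/
noncomputable def prim (x : ℝ → PhaseSpace n) (t : ℝ) : PhaseSpace n :=
  ∫ s in (0 : ℝ)..t, x s

/-- Twice the symplectic area swept by two velocity fields on `[0, T]`. -/
noncomputable def area (T : ℝ) (x y : ℝ → PhaseSpace n) : ℝ :=
  ∫ t in (0 : ℝ)..T, omega (prim x t) (y t)

variable {T : ℝ} {x y z : ℝ → PhaseSpace n}

theorem _root_.IntervalIntegrable.mono_right {E : Type*} [NormedAddCommGroup E] {f : ℝ → E}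
    {a b t : ℝ} (hf : IntervalIntegrable f volume a b) (ht : t ∈ Icc a b) :
    IntervalIntegrable f volume a t :=
  hf.mono_set (by
    rw [uIcc_of_le ht.1, uIcc_of_le (ht.1.trans ht.2)]
    exact Icc_subset_Icc_right ht.2)

theorem continuousOn_prim (hx : IntervalIntegrable x volume 0 T) :
    ContinuousOn (prim x) (uIcc 0 T) :=
  intervalIntegral.continuousOn_primitive_interval' hx left_mem_uIcc

theorem prim_add (hx : IntervalIntegrable x volume 0 T) (hy : IntervalIntegrable y volume 0 T)
    {t : ℝ} (ht : t ∈ Icc 0 T) : prim (fun s => x s + y s) t = prim x t + prim y t :=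
  intervalIntegral.integral_add (hx.mono_right ht) (hy.mono_right ht)

theorem prim_smul (a : ℝ) (t : ℝ) : prim (fun s => a • x s) t = a • prim x t :=
  intervalIntegral.integral_smul _ _

theorem prim_congr_ae (h : x =ᵐ[volume.restrict (Ioc 0 T)] y) {t : ℝ} (ht : t ∈ Icc 0 T) :
    prim x t = prim y t := by
  refine intervalIntegral.integral_congr_ae ?_
  rw [uIoc_of_le ht.1]
  have h' := (ae_restrict_iff' measurableSet_Ioc).1 h
  filter_upwards [h'] with s hs hst
  exact hs ⟨hst.1, hst.2.trans ht.2⟩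

theorem norm_prim_le (hx : IntervalIntegrable x volume 0 T) {t : ℝ} (ht : t ∈ Icc 0 T) :
    ‖prim x t‖ ≤ ∫ s in (0 : ℝ)..T, ‖x s‖ := by
  refine (intervalIntegral.norm_integral_le_integral_norm ht.1).trans ?_
  exact intervalIntegral.integral_mono_interval le_rfl ht.1 ht.2
    (Eventually.of_forall fun _ => norm_nonneg _) hx.norm

theorem intervalIntegrable_omega {u : ℝ → PhaseSpace n} (hu : ContinuousOn u (uIcc 0 T))
    (hy : IntervalIntegrable y volume 0 T) :
    IntervalIntegrable (fun t => omega (u t) (y t)) volume 0 T := by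
  obtain ⟨C, hC⟩ := isCompact_uIcc.exists_bound_of_continuousOn hu
  have hm : AEStronglyMeasurable (fun t => omega (u t) (y t)) (volume.restrict (uIoc 0 T)) := by
    refine continuous_omega.comp_aestronglyMeasurable (AEStronglyMeasurable.prodMk ?_ ?_)
    · exact (hu.mono uIoc_subset_uIcc).aestronglyMeasurable measurableSet_uIoc
    · exact hy.aestronglyMeasurable_restrict_uIoc
  refine (hy.norm.const_mul C).mono_fun hm ?_
  refine (ae_restrict_iff' measurableSet_uIoc).2 (Eventually.of_forall fun t ht => ?_)
  have h1 := hC t (uIoc_subset_uIcc ht)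
  simp only [Real.norm_eq_abs]
  refine (abs_omega_le _ _).trans ?_
  refine (mul_le_mul_of_nonneg_right h1 (norm_nonneg _)).trans (le_abs_self _)

theorem intervalIntegrable_area (hx : IntervalIntegrable x volume 0 T)
    (hy : IntervalIntegrable y volume 0 T) :
    IntervalIntegrable (fun t => omega (prim x t) (y t)) volume 0 T :=
  intervalIntegrable_omega (continuousOn_prim hx) hy

theorem area_add_left (hT : 0 ≤ T) (hx : IntervalIntegrable x volume 0 T)
    (hy : IntervalIntegrable y volume 0 T) (hz : IntervalIntegrable z volume 0 T) :
    area T (fun t => x t + y t) z = area T x z + area T y z := by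
  rw [area, area, area, ← intervalIntegral.integral_add (intervalIntegrable_area hx hz)
    (intervalIntegrable_area hy hz)]
  refine intervalIntegral.integral_congr fun t ht => ?_
  rw [uIcc_of_le hT] at ht
  simp only [prim_add hx hy ht, omega_add_left]

theorem area_add_right (hx : IntervalIntegrable x volume 0 T)
    (hy : IntervalIntegrable y volume 0 T) (hz : IntervalIntegrable z volume 0 T) :
    area T z (fun t => x t + y t) = area T z x + area T z y := by
  rw [area, area, area, ← intervalIntegral.integral_add (intervalIntegrable_area hz hx)
    (intervalIntegrable_area hz hy)]
  simp only [omega_add_right]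

theorem area_smul_left (a : ℝ) : area T (fun t => a • x t) y = a * area T x y := by
  simp only [area, prim_smul, omega_smul_left, intervalIntegral.integral_const_mul]

theorem area_smul_right (a : ℝ) : area T x (fun t => a • y t) = a * area T x y := by
  simp only [area, omega_smul_right, intervalIntegral.integral_const_mul]

theorem area_congr_ae (hT : 0 ≤ T) {x' y' : ℝ → PhaseSpace n}
    (hx : x =ᵐ[volume.restrict (Ioc 0 T)] x') (hy : y =ᵐ[volume.restrict (Ioc 0 T)] y') :
    area T x y = area T x' y' := by
  refine intervalIntegral.integral_congr_ae ?_
  rw [uIoc_of_le hT]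
  filter_upwards [(ae_restrict_iff' measurableSet_Ioc).1 hy] with t ht htT
  rw [ht htT, prim_congr_ae hx ⟨htT.1.le, htT.2⟩]

theorem abs_area_le (hT : 0 ≤ T) (hx : IntervalIntegrable x volume 0 T)
    (hy : IntervalIntegrable y volume 0 T) :
    |area T x y| ≤ (∫ t in (0 : ℝ)..T, ‖x t‖) * ∫ t in (0 : ℝ)..T, ‖y t‖ := by
  rw [area, ← intervalIntegral.integral_const_mul]
  refine (intervalIntegral.abs_integral_le_integral_abs hT).trans ?_
  refine intervalIntegral.integral_mono_on hT (intervalIntegrable_area hx hy).abs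
    (hy.norm.const_mul _) fun t ht => ?_
  exact (abs_omega_le _ _).trans
    (mul_le_mul_of_nonneg_right (norm_prim_le hx ht) (norm_nonneg _))

theorem integral_omega_add_prim (b : PhaseSpace n) (hx : IntervalIntegrable x volume 0 T)
    (hy : IntervalIntegrable y volume 0 T) :
    ∫ t in (0 : ℝ)..T, omega (b + prim x t) (y t) = omega b (prim y T) + area T x y := by
  have h1 : IntervalIntegrable (fun t => omega b (y t)) volume 0 T :=
    intervalIntegrable_omega continuousOn_const hy
  simp only [omega_add_left]
  rw [intervalIntegral.integral_add h1 (intervalIntegrable_area hx hy), area]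
  congr 1
  simp only [← omegaL_apply]
  exact (omegaL b).intervalIntegral_comp_comm hy

/-- Integration by parts for absolutely continuous functions, since the densities are merely
integrable. -/
theorem integral_mul_primitive_eq {f g : ℝ → ℝ} (hf : IntervalIntegrable f volume 0 T)
    (hg : IntervalIntegrable g volume 0 T) :
    ∫ t in (0 : ℝ)..T, (∫ s in (0 : ℝ)..t, f s) * g t =
      (∫ s in (0 : ℝ)..T, f s) * (∫ s in (0 : ℝ)..T, g s) -
        ∫ t in (0 : ℝ)..T, f t * ∫ s in (0 : ℝ)..t, g s := by
  have hF := hf.absolutelyContinuousOnInterval_intervalIntegral (c := 0) left_mem_uIcc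
  have hG := hg.absolutelyContinuousOnInterval_intervalIntegral (c := 0) left_mem_uIcc
  have h := hF.integral_mul_deriv_eq_deriv_mul hG
  have h1 : ∫ t in (0 : ℝ)..T, (∫ s in (0 : ℝ)..t, f s) * deriv (fun r => ∫ s in (0 : ℝ)..r, g s) t =
      ∫ t in (0 : ℝ)..T, (∫ s in (0 : ℝ)..t, f s) * g t := by
    refine intervalIntegral.integral_congr_ae ?_
    filter_upwards [hg.ae_hasDerivAt_integral] with t ht htT
    rw [(ht (uIoc_subset_uIcc htT) 0 left_mem_uIcc).deriv]
  have h2 : ∫ t in (0 : ℝ)..T, deriv (fun r => ∫ s in (0 : ℝ)..r, f s) t * (∫ s in (0 : ℝ)..t, g s) =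
      ∫ t in (0 : ℝ)..T, f t * ∫ s in (0 : ℝ)..t, g s := by
    refine intervalIntegral.integral_congr_ae ?_
    filter_upwards [hf.ae_hasDerivAt_integral] with t ht htT
    rw [(ht (uIoc_subset_uIcc htT) 0 left_mem_uIcc).deriv]
  rw [h1, h2] at h
  simpa using h

theorem intervalIntegrable_coord (hx : IntervalIntegrable x volume 0 T) (i : Fin n ⊕ Fin n) :
    IntervalIntegrable (fun t => x t i) volume 0 T :=
  ⟨(EuclideanSpace.proj (𝕜 := ℝ) i).integrable_comp hx.1,
    (EuclideanSpace.proj (𝕜 := ℝ) i).integrable_comp hx.2⟩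

theorem prim_coord (hx : IntervalIntegrable x volume 0 T) {t : ℝ} (ht : t ∈ uIcc 0 T)
    (i : Fin n ⊕ Fin n) : prim x t i = ∫ s in (0 : ℝ)..t, x s i :=
  ((EuclideanSpace.proj (𝕜 := ℝ) i).intervalIntegral_comp_comm
    (hx.mono_set (uIcc_subset_uIcc left_mem_uIcc ht))).symm

theorem area_eq_sum (hx : IntervalIntegrable x volume 0 T)
    (hy : IntervalIntegrable y volume 0 T) :
    area T x y = ∑ i : Fin n,
      ((∫ t in (0 : ℝ)..T, (∫ s in (0 : ℝ)..t, x s (Sum.inl i)) * y t (Sum.inr i)) -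
        ∫ t in (0 : ℝ)..T, (∫ s in (0 : ℝ)..t, x s (Sum.inr i)) * y t (Sum.inl i)) := by
  have hint : ∀ i j, IntervalIntegrable (fun t => (∫ s in (0 : ℝ)..t, x s i) * y t j) volume 0 T :=
    fun i j => (intervalIntegrable_coord hy j).continuousOn_mul
      (intervalIntegral.continuousOn_primitive_interval' (intervalIntegrable_coord hx i)
        left_mem_uIcc)
  have h1 : area T x y = ∫ t in (0 : ℝ)..T, ∑ i : Fin n,
      ((∫ s in (0 : ℝ)..t, x s (Sum.inl i)) * y t (Sum.inr i) -
        (∫ s in (0 : ℝ)..t, x s (Sum.inr i)) * y t (Sum.inl i)) := by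
    refine intervalIntegral.integral_congr fun t ht => ?_
    simp only [omega, prim_coord hx ht]
  rw [h1]
  refine (intervalIntegral.integral_finsetSum fun (i : Fin n) _ =>
    (hint (Sum.inl i) (Sum.inr i)).sub (hint (Sum.inr i) (Sum.inl i))).trans ?_
  exact Finset.sum_congr rfl fun i _ => intervalIntegral.integral_sub (hint _ _) (hint _ _)

/-- Integration by parts in each coordinate. The boundary term vanishes when one field has zero
mean, so the area is symmetric on loops. -/
theorem area_sub_area (hx : IntervalIntegrable x volume 0 T)
    (hy : IntervalIntegrable y volume 0 T) :
    area T x y - area T y x = omega (prim x T) (prim y T) := by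
  rw [area_eq_sum hx hy, area_eq_sum hy hx, omega, ← Finset.sum_sub_distrib]
  refine Finset.sum_congr rfl fun i _ => ?_
  rw [integral_mul_primitive_eq (intervalIntegrable_coord hx _) (intervalIntegrable_coord hy _),
    integral_mul_primitive_eq (intervalIntegrable_coord hx _) (intervalIntegrable_coord hy _)]
  simp only [prim_coord hx right_mem_uIcc, prim_coord hy right_mem_uIcc, mul_comm (x _ _)]
  ring

theorem area_comm_of_left (hx : IntervalIntegrable x volume 0 T)
    (hy : IntervalIntegrable y volume 0 T) (h : prim x T = 0) : area T x y = area T y x := by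
  have := area_sub_area hx hy
  rw [h, omega_zero_left] at this
  linarith

end CharDyn

/-! ### Weak convergence and the compactness of the Volterra operator. -/

namespace CharDyn

open Filter Topology

/-- Sequential Banach–Alaoglu, transported through the Riesz isomorphism. -/
theorem exists_weakly_convergent_subseq {H : Type*} [NormedAddCommGroup H] [InnerProductSpace ℝ H]
    [CompleteSpace H] [TopologicalSpace.SeparableSpace H] {u : ℕ → H} {R : ℝ}
    (hu : ∀ k, ‖u k‖ ≤ R) :
    ∃ (a : H) (φ : ℕ → ℕ), StrictMono φ ∧
      ∀ y, Tendsto (fun k => inner ℝ (u (φ k)) y) atTop (𝓝 (inner ℝ a y)) := by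
  let D : ℕ → WeakDual ℝ H := fun k =>
    StrongDual.toWeakDual (InnerProductSpace.toDual ℝ H (u k))
  have hD : ∀ k, D k ∈ WeakDual.toStrongDual ⁻¹' Metric.closedBall (0 : StrongDual ℝ H) R := by
    intro k
    simp only [mem_preimage, mem_closedBall_zero_iff]
    exact ((InnerProductSpace.toDual ℝ H).norm_map (u k)).trans_le (hu k)
  obtain ⟨a, -, φ, hφ, hlim⟩ := WeakDual.isSeqCompact_closedBall ℝ H 0 R hD
  refine ⟨(InnerProductSpace.toDual ℝ H).symm (WeakDual.toStrongDual a), φ, hφ, fun y => ?_⟩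
  have h := ((WeakDual.eval_continuous (𝕜 := ℝ) (E := H) y).tendsto a).comp hlim
  rw [InnerProductSpace.toDual_symm_apply]
  exact h

/-- Closed convex sets are cut out by half-spaces, and half-spaces are weakly closed. -/
theorem mem_of_weak_limit {H : Type*} [NormedAddCommGroup H] [InnerProductSpace ℝ H]
    [CompleteSpace H] {C : Set H} (hconv : Convex ℝ C) (hclosed : IsClosed C) {u : ℕ → H} {a : H}
    (hu : ∀ k, u k ∈ C)
    (hlim : ∀ y, Tendsto (fun k => inner ℝ (u k) y) atTop (𝓝 (inner ℝ a y))) : a ∈ C := by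
  by_contra ha
  obtain ⟨f, s, h1, h2⟩ := geometric_hahn_banach_closed_point hconv hclosed ha
  have hf : ∀ x, f x = inner ℝ x ((InnerProductSpace.toDual ℝ H).symm f) := fun x => by
    rw [real_inner_comm, InnerProductSpace.toDual_symm_apply]
  have h3 : f a ≤ s := by
    rw [hf]
    refine le_of_tendsto (hlim _) (Eventually.of_forall fun k => ?_)
    rw [← hf]
    exact (h1 _ (hu k)).le
  exact absurd h2 (not_lt.2 h3)

variable {n : ℕ} {T : ℝ}

/-- Square-integrable velocity fields on `(0, T]`. -/
abbrev L2 (n : ℕ) (T : ℝ) : Type :=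
  Lp (PhaseSpace n) 2 (volume.restrict (Ioc (0 : ℝ) T))

theorem memLp_intervalIntegrable (hT : 0 ≤ T) {E : Type*} [NormedAddCommGroup E] {x : ℝ → E}
    (hx : MemLp x 2 (volume.restrict (Ioc 0 T))) : IntervalIntegrable x volume 0 T :=
  (intervalIntegrable_iff_integrableOn_Ioc_of_le hT).2 (hx.integrable one_le_two)

theorem L2.intervalIntegrable (hT : 0 ≤ T) (x : L2 n T) : IntervalIntegrable x volume 0 T :=
  memLp_intervalIntegrable hT (Lp.memLp x)

theorem L2.exists_integral_norm_le (hT : 0 ≤ T) :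
    ∃ C : ℝ, 0 ≤ C ∧ ∀ x : L2 n T, ∫ t in (0 : ℝ)..T, ‖x t‖ ≤ C * ‖x‖ := by
  refine ⟨((volume.restrict (Ioc 0 T) univ) ^ (1 / (1 : ENNReal).toReal - 1 / (2 : ENNReal).toReal)).toReal,
    ENNReal.toReal_nonneg, fun x => ?_⟩
  have h := eLpNorm_le_eLpNorm_mul_rpow_measure_univ (p := 1) (q := 2) one_le_two
    (Lp.aestronglyMeasurable x)
  rw [intervalIntegral.integral_of_le hT, integral_norm_eq_lintegral_enorm
    (Lp.aestronglyMeasurable x), ← eLpNorm_one_eq_lintegral_enorm, Lp.norm_def, mul_comm,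
    ← ENNReal.toReal_mul]
  refine ENNReal.toReal_mono ?_ h
  refine ENNReal.mul_ne_top (Lp.eLpNorm_ne_top x) ?_
  exact ENNReal.rpow_ne_top_of_nonneg (by norm_num) (measure_ne_top _ _)

theorem L2.prim_add (hT : 0 ≤ T) (x y : L2 n T) {t : ℝ} (ht : t ∈ Icc 0 T) :
    prim (x + y : L2 n T) t = prim x t + prim y t := by
  rw [← CharDyn.prim_add (x.intervalIntegrable hT) (y.intervalIntegrable hT) ht]
  exact prim_congr_ae (Lp.coeFn_add x y) ht

theorem L2.prim_smul (a : ℝ) (x : L2 n T) {t : ℝ} (ht : t ∈ Icc 0 T) :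
    prim (a • x : L2 n T) t = a • prim x t := by
  rw [← CharDyn.prim_smul]
  exact prim_congr_ae (Lp.coeFn_smul a x) ht

/-- Evaluating the primitive at a time is a continuous functional on $L^2$, so weak convergence of
velocities gives pointwise convergence of curves. -/
theorem L2.inner_prim (x : L2 n T) {t : ℝ} (ht : t ∈ Icc 0 T) (c : PhaseSpace n) :
    inner ℝ c (prim x t) =
      inner ℝ (indicatorConstLp 2 (measurableSet_Ioc (a := 0) (b := t))
        (measure_ne_top (volume.restrict (Ioc 0 T)) _) c) x := by
  rw [L2.inner_indicatorConstLp_eq_inner_setIntegral, Measure.restrict_restrict measurableSet_Ioc,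
    inter_eq_left.2 (Ioc_subset_Ioc_right ht.2), prim, intervalIntegral.integral_of_le ht.1]

theorem L2.tendsto_prim {u : ℕ → L2 n T} {a : L2 n T}
    (hlim : ∀ y, Tendsto (fun k => inner ℝ (u k) y) atTop (𝓝 (inner ℝ a y))) {t : ℝ}
    (ht : t ∈ Icc 0 T) : Tendsto (fun k => prim (u k) t) atTop (𝓝 (prim a t)) := by
  have h : ∀ c : PhaseSpace n,
      Tendsto (fun k => inner ℝ c (prim (u k) t)) atTop (𝓝 (inner ℝ c (prim a t))) := by
    intro c
    simp only [L2.inner_prim _ ht]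
    simp only [real_inner_comm _ (indicatorConstLp _ _ _ _)]
    exact hlim _
  have h2 : Tendsto (fun k => (prim (u k) t).ofLp) atTop (𝓝 (prim a t).ofLp) := by
    refine tendsto_pi_nhds.2 fun i => ?_
    simpa [EuclideanSpace.inner_single_left] using h (EuclideanSpace.single i 1)
  exact ((PiLp.continuous_toLp 2 _).tendsto _).comp h2

theorem memLp_J_prim (hT : 0 ≤ T) {x : ℝ → PhaseSpace n} (hx : IntervalIntegrable x volume 0 T) :
    MemLp (fun t => J (prim x t)) 2 (volume.restrict (Ioc 0 T)) := by
  have hJ : Continuous (J (n := n)) := LinearMap.continuous_of_finiteDimensional _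
  have hc : ContinuousOn (fun t => J (prim x t)) (Icc 0 T) := by
    rw [← uIcc_of_le hT]
    exact hJ.comp_continuousOn (continuousOn_prim hx)
  refine MemLp.of_bound ((hc.mono Ioc_subset_Icc_self).aestronglyMeasurable measurableSet_Ioc)
    (∫ t in (0 : ℝ)..T, ‖x t‖) ?_
  refine (ae_restrict_iff' measurableSet_Ioc).2 (Eventually.of_forall fun t ht => ?_)
  rw [norm_J]
  exact norm_prim_le hx (Ioc_subset_Icc_self ht)

/-- The Volterra operator `x ↦ J ∫₀ᵗ x`, which represents `area`. -/
noncomputable def volterra (hT : 0 ≤ T) (x : L2 n T) : L2 n T :=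
  (memLp_J_prim hT (x.intervalIntegrable hT)).toLp

theorem coeFn_volterra (hT : 0 ≤ T) (x : L2 n T) :
    volterra hT x =ᵐ[volume.restrict (Ioc 0 T)] fun t => J (prim x t) :=
  MemLp.coeFn_toLp _

theorem inner_volterra (hT : 0 ≤ T) (x y : L2 n T) :
    inner ℝ (volterra hT x) y = area T x y := by
  rw [L2.inner_def, area, intervalIntegral.integral_of_le hT]
  refine integral_congr_ae ?_
  filter_upwards [coeFn_volterra hT x] with t ht
  rw [ht, inner_J]

/-- The primitives converge pointwise and are uniformly bounded, so dominated convergence makes the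
convergence strong. -/
theorem tendsto_volterra (hT : 0 ≤ T) {u : ℕ → L2 n T} {a : L2 n T} {R : ℝ}
    (hR : ∀ k, ‖u k‖ ≤ R)
    (hlim : ∀ y, Tendsto (fun k => inner ℝ (u k) y) atTop (𝓝 (inner ℝ a y))) :
    Tendsto (fun k => volterra hT (u k)) atTop (𝓝 (volterra hT a)) := by
  obtain ⟨C, hC0, hC⟩ := L2.exists_integral_norm_le (n := n) hT
  rw [tendsto_iff_norm_sub_tendsto_zero]
  have hsq : ∀ k, ‖volterra hT (u k) - volterra hT a‖ ^ 2 =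
      ∫ t in Ioc 0 T, ‖prim (u k) t - prim a t‖ ^ 2 := by
    intro k
    rw [← real_inner_self_eq_norm_sq, L2.inner_def]
    refine integral_congr_ae ?_
    filter_upwards [coeFn_volterra hT (u k), coeFn_volterra hT a,
      Lp.coeFn_sub (volterra hT (u k)) (volterra hT a)] with t h1 h2 h3
    rw [h3, Pi.sub_apply, h1, h2, ← map_sub, real_inner_self_eq_norm_sq, norm_J]
  have hcont : ∀ k, AEStronglyMeasurable (fun t => ‖prim (u k) t - prim a t‖ ^ 2)
      (volume.restrict (Ioc 0 T)) := by
    intro k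
    have h1 := continuousOn_prim ((u k).intervalIntegrable hT)
    have h2 := continuousOn_prim (a.intervalIntegrable hT)
    rw [uIcc_of_le hT] at h1 h2
    exact (((h1.sub h2).norm.pow 2).mono Ioc_subset_Icc_self).aestronglyMeasurable
      measurableSet_Ioc
  have h0 : Tendsto (fun k => ‖volterra hT (u k) - volterra hT a‖ ^ 2) atTop (𝓝 0) := by
    simp only [hsq]
    have := tendsto_integral_of_dominated_convergence (μ := volume.restrict (Ioc 0 T))
      (F := fun k t => ‖prim (u k) t - prim a t‖ ^ 2) (f := fun _ => (0 : ℝ))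
      (fun _ => (C * R + C * ‖a‖) ^ 2) hcont (integrable_const _) ?_ ?_
    · simpa using this
    · intro k
      refine (ae_restrict_iff' measurableSet_Ioc).2 (Eventually.of_forall fun t ht => ?_)
      rw [Real.norm_of_nonneg (by positivity)]
      refine pow_le_pow_left₀ (norm_nonneg _) ((norm_sub_le _ _).trans (add_le_add ?_ ?_)) 2
      · exact ((norm_prim_le ((u k).intervalIntegrable hT) (Ioc_subset_Icc_self ht)).trans
          (hC _)).trans (mul_le_mul_of_nonneg_left (hR k) hC0)
      · exact (norm_prim_le (a.intervalIntegrable hT) (Ioc_subset_Icc_self ht)).trans (hC _)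
    · refine (ae_restrict_iff' measurableSet_Ioc).2 (Eventually.of_forall fun t ht => ?_)
      have := (L2.tendsto_prim hlim (Ioc_subset_Icc_self ht)).sub_const (prim a t)
      simpa using (this.norm.pow 2)
  have := (Real.continuous_sqrt.tendsto _).comp h0
  simpa [Function.comp_def, Real.sqrt_sq (norm_nonneg _)] using this

/-- The area pairs a strongly convergent sequence with a bounded, weakly convergent one. -/
theorem tendsto_area (hT : 0 ≤ T) {u : ℕ → L2 n T} {a : L2 n T} {R : ℝ}
    (hR : ∀ k, ‖u k‖ ≤ R)
    (hlim : ∀ y, Tendsto (fun k => inner ℝ (u k) y) atTop (𝓝 (inner ℝ a y))) :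
    Tendsto (fun k => area T (u k) (u k)) atTop (𝓝 (area T a a)) := by
  have h1 := tendsto_iff_norm_sub_tendsto_zero.1 (tendsto_volterra hT hR hlim)
  have h2 : Tendsto (fun k => inner ℝ (volterra hT (u k) - volterra hT a) (u k)) atTop
      (𝓝 (0 : ℝ)) := by
    refine squeeze_zero_norm (fun k => ?_) (by simpa using h1.mul_const R)
    exact (norm_inner_le_norm _ _).trans (mul_le_mul_of_nonneg_left (hR k) (norm_nonneg _))
  have h3 := h2.add (hlim (volterra hT a))
  rw [zero_add, real_inner_comm, inner_volterra] at h3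
  refine h3.congr fun k => ?_
  rw [inner_sub_left, real_inner_comm (volterra hT a) (u k), inner_volterra]
  rw [real_inner_comm]
  ring

end CharDyn

/-! ### The dual isoperimetric inequality. -/

namespace CharDyn

open Filter Topology

variable {n : ℕ} {T : ℝ} {K : Set (PhaseSpace n)}

/-- The `L²` norm of `charLength K ∘ x`. -/
noncomputable def lengthNorm (K : Set (PhaseSpace n)) (x : L2 n T) : ℝ :=
  √(∫ t in Ioc 0 T, charLength K (x t) ^ 2)

theorem lengthNorm_nonneg (x : L2 n T) : 0 ≤ lengthNorm K x := Real.sqrt_nonneg _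

theorem lengthNorm_sq (x : L2 n T) :
    lengthNorm K x ^ 2 = ∫ t in Ioc 0 T, charLength K (x t) ^ 2 :=
  Real.sq_sqrt (integral_nonneg fun _ => sq_nonneg _)

/-- Continuity and subadditivity are inherited from the $L^2$ norm through composition with a
Lipschitz function. -/
theorem lengthNorm_eq_norm_compLp {R : NNReal} (hL : LipschitzWith R (charLength K))
    (he0 : charLength K 0 = 0) (x : L2 n T) : lengthNorm K x = ‖hL.compLp he0 x‖ := by
  rw [lengthNorm, ← Real.sqrt_sq (norm_nonneg (hL.compLp he0 x)), ← real_inner_self_eq_norm_sq,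
    L2.inner_def]
  congr 1
  refine integral_congr_ae ?_
  filter_upwards [hL.coeFn_compLp he0 x] with t ht
  rw [ht, real_inner_self_eq_norm_sq, Function.comp_apply, Real.norm_eq_abs, sq_abs]

theorem lengthNorm_smul (hcomp : IsCompact K) (hne : K.Nonempty) {a : ℝ} (ha : 0 ≤ a)
    (x : L2 n T) : lengthNorm K (a • x) = a * lengthNorm K x := by
  rw [lengthNorm, lengthNorm, ← Real.sqrt_sq ha, ← Real.sqrt_mul (sq_nonneg a),
    ← integral_const_mul, Real.sqrt_sq ha]
  congr 1
  refine integral_congr_ae ?_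
  filter_upwards [Lp.coeFn_smul a x] with t ht
  rw [ht, Pi.smul_apply, charLength_smul hcomp hne ha, mul_pow]

theorem lengthNorm_add_le (hcomp : IsCompact K) (h0 : (0 : PhaseSpace n) ∈ K)
    (x y : L2 n T) : lengthNorm K (x + y) ≤ lengthNorm K x + lengthNorm K y := by
  obtain ⟨R, hL⟩ := exists_charLength_lipschitz hcomp ⟨0, h0⟩
  have he0 := charLength_zero (K := K) hcomp ⟨0, h0⟩
  simp only [lengthNorm_eq_norm_compLp hL he0]
  refine le_trans ?_ (norm_add_le _ _)
  refine Lp.norm_le_norm_of_ae_le ?_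
  filter_upwards [hL.coeFn_compLp he0 x, hL.coeFn_compLp he0 y, hL.coeFn_compLp he0 (x + y),
    Lp.coeFn_add x y, Lp.coeFn_add (hL.compLp he0 x) (hL.compLp he0 y)] with t h1 h2 h3 h4 h5
  rw [h3, h5, Pi.add_apply, h1, h2, Function.comp_apply, h4, Pi.add_apply, Function.comp_apply,
    Function.comp_apply, Real.norm_of_nonneg (charLength_nonneg hcomp h0 _), Real.norm_of_nonneg
    (add_nonneg (charLength_nonneg hcomp h0 _) (charLength_nonneg hcomp h0 _))]
  exact charLength_add_le hcomp ⟨0, h0⟩ _ _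

theorem continuous_lengthNorm (hcomp : IsCompact K) (hne : K.Nonempty) :
    Continuous (lengthNorm K : L2 n T → ℝ) := by
  obtain ⟨R, hL⟩ := exists_charLength_lipschitz hcomp hne
  have he0 := charLength_zero (K := K) hcomp hne
  rw [funext (lengthNorm_eq_norm_compLp hL he0)]
  exact (hL.continuous_compLp he0).norm

theorem exists_lengthNorm_le (hcomp : IsCompact K) (hne : K.Nonempty) :
    ∃ R : ℝ, ∀ x : L2 n T, lengthNorm K x ≤ R * ‖x‖ := by
  obtain ⟨R, hL⟩ := exists_charLength_lipschitz hcomp hne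
  have he0 := charLength_zero (K := K) hcomp hne
  refine ⟨R, fun x => ?_⟩
  rw [lengthNorm_eq_norm_compLp hL he0]
  exact hL.norm_compLp_le he0 x

theorem exists_mul_norm_le_lengthNorm (hcomp : IsCompact K)
    (h0 : (0 : PhaseSpace n) ∈ interior K) :
    ∃ r > 0, ∀ x : L2 n T, r * ‖x‖ ≤ lengthNorm K x := by
  have hne : K.Nonempty := ⟨0, interior_subset h0⟩
  obtain ⟨R, hL⟩ := exists_charLength_lipschitz hcomp hne
  have he0 := charLength_zero (K := K) hcomp hne
  obtain ⟨r, hr, h⟩ := exists_mul_norm_le_charLength hcomp h0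
  refine ⟨r, hr, fun x => ?_⟩
  rw [← le_inv_mul_iff₀ hr, lengthNorm_eq_norm_compLp hL he0]
  refine Lp.norm_le_mul_norm_of_ae_le_mul ?_
  filter_upwards [hL.coeFn_compLp he0 x] with t ht
  rw [ht, le_inv_mul_iff₀ hr, Function.comp_apply]
  exact (h _).trans (le_abs_self _)

theorem convex_lengthNorm_le (hcomp : IsCompact K) (h0 : (0 : PhaseSpace n) ∈ K) (s : ℝ) :
    Convex ℝ {x : L2 n T | lengthNorm K x ≤ s} := by
  intro x hx y hy a b ha hb hab
  have hx' : lengthNorm K x ≤ s := hx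
  have hy' : lengthNorm K y ≤ s := hy
  refine (lengthNorm_add_le hcomp h0 _ _).trans ?_
  rw [lengthNorm_smul hcomp ⟨0, h0⟩ ha, lengthNorm_smul hcomp ⟨0, h0⟩ hb]
  calc _ ≤ a * s + b * s :=
        add_le_add (mul_le_mul_of_nonneg_left hx' ha) (mul_le_mul_of_nonneg_left hy' hb)
    _ = s := by rw [← add_mul, hab, one_mul]

/-- The velocity fields of loops. -/
def zeroMean (n : ℕ) (hT : 0 ≤ T) : Submodule ℝ (L2 n T) where
  carrier := {x | prim x T = 0}
  add_mem' {x y} hx hy := by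
    change prim x T = 0 at hx
    change prim y T = 0 at hy
    change prim (x + y : L2 n T) T = 0
    rw [L2.prim_add hT x y ⟨hT, le_rfl⟩, hx, hy, add_zero]
  zero_mem' := by
    have := L2.prim_smul 0 (0 : L2 n T) (t := T) ⟨hT, le_rfl⟩
    rwa [zero_smul, zero_smul] at this
  smul_mem' a x hx := by
    change prim x T = 0 at hx
    change prim (a • x : L2 n T) T = 0
    rw [L2.prim_smul a x ⟨hT, le_rfl⟩, hx, smul_zero]

theorem mem_zeroMean {hT : 0 ≤ T} {x : L2 n T} : x ∈ zeroMean n hT ↔ prim x T = 0 := Iff.rfl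

theorem L2.area_smul_smul (hT : 0 ≤ T) (a : ℝ) (x : L2 n T) :
    area T (a • x : L2 n T) (a • x : L2 n T) = a ^ 2 * area T x x := by
  rw [area_congr_ae hT (Lp.coeFn_smul a x) (Lp.coeFn_smul a x)]
  change area T (fun t => a • x t) (fun t => a • x t) = _
  rw [area_smul_left, area_smul_right]
  ring

theorem L2.area_add_smul (hT : 0 ≤ T) {x : L2 n T} (hx : x ∈ zeroMean n hT) (s : ℝ)
    (y : L2 n T) :
    area T (x + s • y : L2 n T) (x + s • y : L2 n T) =
      area T x x + 2 * s * area T x y + s ^ 2 * area T y y := by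
  have h : (x + s • y : L2 n T) =ᵐ[volume.restrict (Ioc 0 T)] fun t => x t + s • y t := by
    filter_upwards [Lp.coeFn_add x (s • y), Lp.coeFn_smul s y] with t h1 h2
    rw [h1, Pi.add_apply, h2, Pi.smul_apply]
  have ix := x.intervalIntegrable hT
  have iy := y.intervalIntegrable hT
  have isy : IntervalIntegrable (fun t => s • y t) volume 0 T := iy.smul s
  rw [area_congr_ae hT h h, area_add_left hT ix isy (ix.add isy), area_add_right ix isy ix,
    area_add_right ix isy isy, area_smul_left, area_smul_left, area_smul_right, area_smul_right,
    area_comm_of_left ix iy hx]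
  ring

/-- The direct method: the constraints survive weak limits and the area is weakly continuous. The
test field `x₀` guarantees that the maximum is positive. -/
theorem exists_isoperimetric_maximizer (hT : 0 ≤ T) (hcomp : IsCompact K)
    (h0 : (0 : PhaseSpace n) ∈ interior K) {x₀ : L2 n T} (hx₀ : x₀ ∈ zeroMean n hT)
    (hpos : 0 < area T x₀ x₀) :
    ∃ a ∈ zeroMean n hT, lengthNorm K a = 1 ∧ 0 < area T a a ∧
      ∀ x ∈ zeroMean n hT, area T x x ≤ area T a a * lengthNorm K x ^ 2 := by
  have h0K := interior_subset h0
  have hne : K.Nonempty := ⟨0, h0K⟩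
  have : Fact ((2 : ENNReal) ≠ ⊤) := ⟨ENNReal.ofNat_ne_top⟩
  obtain ⟨r, hr, hrx⟩ := exists_mul_norm_le_lengthNorm (T := T) hcomp h0
  obtain ⟨C, hC0, hC⟩ := L2.exists_integral_norm_le (n := n) hT
  let S : Set ℝ := (fun x : L2 n T => area T x x) '' {x | x ∈ zeroMean n hT ∧ lengthNorm K x ≤ 1}
  have hnorm : ∀ x : L2 n T, lengthNorm K x ≤ 1 → ‖x‖ ≤ r⁻¹ := fun x hx => by
    rw [← one_div, le_div_iff₀' hr]
    exact (hrx x).trans hx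
  have hbdd : BddAbove S := by
    refine ⟨(C * r⁻¹) * (C * r⁻¹), ?_⟩
    rintro _ ⟨x, ⟨-, hx⟩, rfl⟩
    have ix := x.intervalIntegrable hT
    have h1 : ∫ t in (0 : ℝ)..T, ‖x t‖ ≤ C * r⁻¹ :=
      (hC x).trans (mul_le_mul_of_nonneg_left (hnorm x hx) hC0)
    refine (le_abs_self _).trans ((abs_area_le hT ix ix).trans ?_)
    exact mul_le_mul h1 h1 (intervalIntegral.integral_nonneg hT fun _ _ => norm_nonneg _)
      (by positivity)
  have hl0 : lengthNorm K (0 : L2 n T) = 0 := by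
    simpa using lengthNorm_smul (T := T) hcomp hne le_rfl (0 : L2 n T)
  have hSne : S.Nonempty := ⟨_, 0, ⟨Submodule.zero_mem _, by rw [hl0]; exact zero_le_one⟩, rfl⟩
  obtain ⟨v, -, hv, hvS⟩ := exists_seq_tendsto_sSup hSne hbdd
  choose u hu hua using hvS
  obtain ⟨a, φ, hφ, hlim⟩ := exists_weakly_convergent_subseq fun k => hnorm _ (hu k).2
  have harea : area T a a = sSup S := by
    refine tendsto_nhds_unique (tendsto_area hT (fun k => hnorm _ (hu (φ k)).2) hlim) ?_
    refine (hv.comp hφ.tendsto_atTop).congr fun k => ?_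
    rw [Function.comp_apply, ← hua]
  have ha1 : lengthNorm K a ≤ 1 :=
    mem_of_weak_limit (convex_lengthNorm_le hcomp h0K 1)
      (isClosed_le (continuous_lengthNorm hcomp hne) continuous_const) (fun k => (hu (φ k)).2) hlim
  have ha0 : a ∈ zeroMean n hT := by
    refine tendsto_nhds_unique (L2.tendsto_prim hlim ⟨hT, le_rfl⟩) ?_
    refine tendsto_const_nhds.congr fun k => ?_
    exact (mem_zeroMean.1 (hu (φ k)).1).symm
  have hmax : ∀ x ∈ zeroMean n hT, area T x x ≤ area T a a * lengthNorm K x ^ 2 := by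
    intro x hx
    rcases (lengthNorm_nonneg x (K := K)).eq_or_lt with hlx | hlx
    · have : x = 0 := by
        rw [← norm_le_zero_iff]
        have := hrx x
        rw [← hlx] at this
        exact nonpos_of_mul_nonpos_right this hr
      have h2 := L2.area_smul_smul hT 0 x
      rw [zero_smul] at h2
      rw [← hlx, this, h2]
      simp
    · have h1 : area T ((lengthNorm K x)⁻¹ • x : L2 n T) ((lengthNorm K x)⁻¹ • x : L2 n T) ∈ S := by
        refine ⟨_, ⟨Submodule.smul_mem _ _ hx, ?_⟩, rfl⟩
        rw [lengthNorm_smul hcomp hne (by positivity), inv_mul_cancel₀ hlx.ne']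
      have h2 := le_csSup hbdd h1
      rw [← harea, L2.area_smul_smul hT, inv_pow, inv_mul_le_iff₀ (by positivity)] at h2
      linarith
  have hm : 0 < area T a a := by
    have := hmax x₀ hx₀
    by_contra hneg
    have := mul_nonpos_of_nonpos_of_nonneg (not_lt.1 hneg) (sq_nonneg (lengthNorm K x₀))
    linarith
  refine ⟨a, ha0, le_antisymm ha1 ?_, hm, hmax⟩
  -- Homogeneity saturates the constraint: apply the inequality to `a` itself and divide by its
  -- positive area.
  have h1 : 1 ≤ lengthNorm K a ^ 2 := by
    have := hmax a ha0
    rwa [le_mul_iff_one_le_right hm] at this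
  exact (one_le_sq_iff₀ (lengthNorm_nonneg _)).1 h1

/-- First variation of the extremal inequality along `a + s • x`. As `lengthNorm` need not be
differentiable, only `s > 0` is used, together with subadditivity. -/
theorem area_le_mul_lengthNorm (hT : 0 ≤ T) (hcomp : IsCompact K)
    (h0 : (0 : PhaseSpace n) ∈ K) {a : L2 n T} (ha : a ∈ zeroMean n hT)
    (hnorm : lengthNorm K a = 1) (hpos : 0 < area T a a)
    (hmax : ∀ x ∈ zeroMean n hT, area T x x ≤ area T a a * lengthNorm K x ^ 2)
    {x : L2 n T} (hx : x ∈ zeroMean n hT) : area T a x ≤ area T a a * lengthNorm K x := by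
  have hne : K.Nonempty := ⟨0, h0⟩
  set m := area T a a
  set p := lengthNorm K x
  have key : ∀ s : ℝ, 0 < s → 2 * area T a x + s * area T x x ≤ 2 * (m * p) + s * (m * p ^ 2) := by
    intro s hs
    have h1 := hmax (a + s • x) (Submodule.add_mem _ ha (Submodule.smul_mem _ s hx))
    rw [L2.area_add_smul hT ha] at h1
    have h2 : lengthNorm K (a + s • x) ≤ 1 + s * p := by
      refine (lengthNorm_add_le hcomp h0 _ _).trans ?_
      rw [hnorm, lengthNorm_smul hcomp hne hs.le]
    have h3 := pow_le_pow_left₀ (lengthNorm_nonneg _) h2 2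
    have h4 := h1.trans (mul_le_mul_of_nonneg_left h3 hpos.le)
    have h5 : s * (2 * area T a x + s * area T x x) ≤ s * (2 * (m * p) + s * (m * p ^ 2)) := by
      linear_combination h4
    exact le_of_mul_le_mul_left h5 hs
  by_contra! hlt
  set δ := area T a x - m * p
  have hδ : 0 < δ := sub_pos.2 hlt
  set c := |m * p ^ 2 - area T x x| + 1
  have hc : 0 < c := by positivity
  -- With this `s` the quadratic remainder is at most `δ`, whereas a violation by `δ` would make it
  -- at least `2 * δ`.
  have h1 := key (δ / c) (by positivity)
  have h2 : δ / c * (m * p ^ 2 - area T x x) ≤ δ := by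
    rw [div_mul_eq_mul_div, div_le_iff₀ hc]
    exact mul_le_mul_of_nonneg_left ((le_abs_self _).trans (le_add_of_nonneg_right zero_le_one))
      hδ.le
  have h3 : 2 * δ ≤ δ / c * (m * p ^ 2 - area T x x) := by
    simp only [δ] at h1 ⊢
    linarith
  linarith

/-- Subtracting the mean of `d` leaves a zero-mean field orthogonal to itself. -/
theorem exists_eq_const_of_orthogonal (hT : 0 < T) {d : L2 n T}
    (hd : ∀ x ∈ zeroMean n hT.le, inner ℝ d x = 0) :
    ∃ b : PhaseSpace n, d = Lp.const 2 (volume.restrict (Ioc 0 T)) b := by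
  set b := T⁻¹ • prim d T
  have hc : ∀ x : L2 n T, inner ℝ (Lp.const 2 (volume.restrict (Ioc 0 T)) b) x =
      inner ℝ b (prim x T) := by
    intro x
    rw [L2.inner_def, prim, intervalIntegral.integral_of_le hT.le, ← integral_inner]
    · refine integral_congr_ae ?_
      filter_upwards [Lp.coeFn_const (p := 2) (μ := volume.restrict (Ioc 0 T)) b] with t ht
      rw [ht, Function.const_apply]
    · exact (Lp.memLp x).integrable one_le_two
  have hp : prim (Lp.const 2 (volume.restrict (Ioc 0 T)) b) T = prim d T := by
    rw [prim_congr_ae (Lp.coeFn_const (p := 2) (μ := volume.restrict (Ioc 0 T)) b)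
      ⟨hT.le, le_rfl⟩, prim]
    simp [b, smul_smul, hT.ne']
  have hmem : d - Lp.const 2 (volume.restrict (Ioc 0 T)) b ∈ zeroMean n hT.le := by
    rw [mem_zeroMean, sub_eq_add_neg, ← neg_one_smul ℝ (Lp.const _ _ b),
      L2.prim_add hT.le _ _ ⟨hT.le, le_rfl⟩, L2.prim_smul _ _ ⟨hT.le, le_rfl⟩, hp]
    simp
  refine ⟨b, sub_eq_zero.1 (inner_self_eq_zero (𝕜 := ℝ).1 ?_)⟩
  rw [inner_sub_left, hd _ hmem, hc, mem_zeroMean.1 hmem, inner_zero_right, sub_zero]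

/-- On zero-mean fields the functional `area T a` is dominated by a sublinear one. Its Hahn–Banach
extension to $L^2$ differs from the Volterra representative by a constant, which becomes the
translation `b`. -/
theorem exists_lagrange_multiplier (hT : 0 < T) (hcomp : IsCompact K)
    (h0 : (0 : PhaseSpace n) ∈ interior K) {a : L2 n T} (ha : a ∈ zeroMean n hT.le)
    (hnorm : lengthNorm K a = 1) (hpos : 0 < area T a a)
    (hmax : ∀ x ∈ zeroMean n hT.le, area T x x ≤ area T a a * lengthNorm K x ^ 2) :
    ∃ b : PhaseSpace n, ∀ y : L2 n T,
      ∫ t in Ioc 0 T, omega (b + prim a t) (y t) ≤ area T a a * lengthNorm K y := by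
  have h0K := interior_subset h0
  have hne : K.Nonempty := ⟨0, h0K⟩
  set m := area T a a
  let f : L2 n T →ₗ.[ℝ] ℝ :=
    ⟨zeroMean n hT.le, (innerₛₗ ℝ (volterra hT.le a)).comp (zeroMean n hT.le).subtype⟩
  obtain ⟨g, hg1, hg2⟩ := exists_extension_of_le_sublinear f (fun x => m * lengthNorm K x)
    (fun c hc x => by
      simp only [lengthNorm_smul hcomp hne hc.le]
      ring)
    (fun x y => by
      rw [← mul_add]
      exact mul_le_mul_of_nonneg_left (lengthNorm_add_le hcomp h0K x y) hpos.le)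
    (fun x => by
      have h := area_le_mul_lengthNorm hT.le hcomp h0K ha hnorm hpos hmax x.2
      rw [← inner_volterra hT.le] at h
      exact h)
  obtain ⟨R, hR⟩ := exists_lengthNorm_le (T := T) hcomp hne
  have hgR : ∀ x, g x ≤ m * R * ‖x‖ := fun x => by
    rw [mul_assoc]
    exact (hg2 x).trans (mul_le_mul_of_nonneg_left (hR x) hpos.le)
  let G : StrongDual ℝ (L2 n T) := g.mkContinuous (m * R) fun x => by
    rw [Real.norm_eq_abs, abs_le']
    refine ⟨hgR x, ?_⟩
    rw [← map_neg, ← norm_neg]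
    exact hgR (-x)
  have hG : ∀ x, inner ℝ ((InnerProductSpace.toDual ℝ (L2 n T)).symm G) x = g x := fun x => by
    rw [InnerProductSpace.toDual_symm_apply]
    rfl
  obtain ⟨b, hb⟩ := exists_eq_const_of_orthogonal hT
    (d := (InnerProductSpace.toDual ℝ (L2 n T)).symm G - volterra hT.le a) fun x hx => by
      rw [inner_sub_left, hG, sub_eq_zero]
      exact hg1 ⟨x, hx⟩
  refine ⟨-J b, fun y => ?_⟩
  have h1 : ∫ t in Ioc 0 T, omega (-J b + prim a t) (y t) = g y := by
    rw [← hG, sub_eq_iff_eq_add.1 hb, L2.inner_def]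
    refine integral_congr_ae ?_
    filter_upwards [coeFn_volterra hT.le a,
      Lp.coeFn_const (p := 2) (μ := volume.restrict (Ioc 0 T)) b,
      Lp.coeFn_add (Lp.const 2 (volume.restrict (Ioc 0 T)) b) (volterra hT.le a)] with t h1 h2 h3
    rw [h3, Pi.add_apply, h1, h2, Function.const_apply, ← inner_J, map_add, map_neg, J_J, neg_neg]
  rw [h1]
  exact hg2 y

theorem integrable_omega_sub_charLength_sq (hT : 0 ≤ T) (hcomp : IsCompact K) (hne : K.Nonempty)
    {Z : ℝ → PhaseSpace n} (hZ : ContinuousOn Z (Icc 0 T)) (c : ℝ) {y : ℝ → PhaseSpace n}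
    (hy : MemLp y 2 (volume.restrict (Ioc 0 T))) :
    Integrable (fun t => omega (Z t) (y t) - c * charLength K (y t) ^ 2)
      (volume.restrict (Ioc 0 T)) := by
  rw [← uIcc_of_le hT] at hZ
  have h1 := (intervalIntegrable_omega hZ (memLp_intervalIntegrable hT hy)).1
  obtain ⟨R, hL⟩ := exists_charLength_lipschitz hcomp hne
  have h2 : MemLp (charLength K ∘ y) 2 (volume.restrict (Ioc 0 T)) :=
    hL.comp_memLp (charLength_zero hcomp hne) hy
  exact Integrable.sub h1 (h2.integrable_sq.const_mul c)

/-- The field `a` maximizes $\int\omega(Z,y)-\frac m2 h_K(-Jy)^2$. Replacing `a` by a constant on an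
arbitrary measurable set localizes this to almost every time, and a dense sequence of constants
gives one null set for all `w`. -/
theorem ae_forall_omega_sub_le (hT : 0 ≤ T) (hcomp : IsCompact K) (hne : K.Nonempty)
    {Z : ℝ → PhaseSpace n} (hZ : ContinuousOn Z (Icc 0 T)) {m : ℝ} (hm : 0 < m) {a : L2 n T}
    (ha : lengthNorm K a = 1) (haZ : ∫ t in Ioc 0 T, omega (Z t) (a t) = m)
    (h : ∀ y : L2 n T, ∫ t in Ioc 0 T, omega (Z t) (y t) ≤ m * lengthNorm K y) :
    ∀ᵐ t ∂volume.restrict (Ioc 0 T), ∀ w,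
      omega (Z t) w - m / 2 * charLength K w ^ 2 ≤
        omega (Z t) (a t) - m / 2 * charLength K (a t) ^ 2 := by
  set μ := volume.restrict (Ioc (0 : ℝ) T)
  let Ψ : (ℝ → PhaseSpace n) → ℝ → ℝ :=
    fun y t => omega (Z t) (y t) - m / 2 * charLength K (y t) ^ 2
  have hΨ : ∀ {y : ℝ → PhaseSpace n}, MemLp y 2 μ → Integrable (Ψ y) μ := fun hy =>
    integrable_omega_sub_charLength_sq hT hcomp hne hZ _ hy
  have hsub : ∀ y : L2 n T, ∫ t, Ψ y t ∂μ =
      (∫ t, omega (Z t) (y t) ∂μ) - m / 2 * lengthNorm K y ^ 2 := by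
    intro y
    have hy := Lp.memLp y
    obtain ⟨R, hL⟩ := exists_charLength_lipschitz hcomp hne
    have h2 : MemLp (charLength K ∘ y) 2 μ := hL.comp_memLp (charLength_zero hcomp hne) hy
    have h1 := intervalIntegrable_omega (T := T) (u := Z) (by rwa [uIcc_of_le hT])
      (memLp_intervalIntegrable hT hy)
    rw [lengthNorm_sq, ← integral_const_mul]
    exact integral_sub h1.1 (h2.integrable_sq.const_mul _)
  have hle : ∀ y : L2 n T, ∫ t, Ψ y t ∂μ ≤ ∫ t, Ψ a t ∂μ := by
    intro y
    rw [hsub, hsub, haZ, ha]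
    -- Completing the square: $m\ell-\frac m2\ell^2\le\frac m2$, and `a` attains this bound.
    nlinarith [h y, mul_nonneg hm.le (sq_nonneg (lengthNorm K y - 1))]
  have hw : ∀ w : PhaseSpace n, ∀ᵐ t ∂μ, Ψ (fun _ => w) t ≤ Ψ a t := by
    intro w
    have hi1 := hΨ (Lp.memLp a)
    have hi2 : Integrable (Ψ fun _ => w) μ := hΨ (memLp_const w)
    have h0 : 0 ≤ᵐ[μ] fun t => Ψ a t - Ψ (fun _ => w) t := by
      refine ae_nonneg_of_forall_setIntegral_nonneg (hi1.sub hi2) fun s hs _ => ?_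
      classical
      have hpw : MemLp (s.piecewise (fun _ => w) a) 2 μ :=
        MemLp.piecewise hs (memLp_const w) ((Lp.memLp a).restrict _)
      have h1 := hle hpw.toLp
      have h2 : ∫ t, Ψ hpw.toLp t ∂μ = ∫ t, Ψ (s.piecewise (fun _ => w) a) t ∂μ := by
        refine integral_congr_ae ?_
        filter_upwards [hpw.coeFn_toLp] with t ht
        simp only [Ψ, ht]
      rw [h2] at h1
      have h3 : ∫ t in s, (Ψ a t - Ψ (fun _ => w) t) ∂μ =
          (∫ t, Ψ a t ∂μ) - ∫ t, Ψ (s.piecewise (fun _ => w) a) t ∂μ := by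
        rw [← integral_sub hi1 (hΨ hpw), ← integral_indicator hs]
        congr 1
        ext t
        by_cases ht : t ∈ s <;> simp [Ψ, ht]
      change 0 ≤ ∫ t in s, (Ψ a t - Ψ (fun _ => w) t) ∂μ
      linarith
    filter_upwards [h0] with t ht
    exact sub_nonneg.1 ht
  have hall := ae_all_iff.2 fun k => hw (TopologicalSpace.denseSeq (PhaseSpace n) k)
  filter_upwards [hall] with t ht w
  have hclosed : IsClosed {w | omega (Z t) w - m / 2 * charLength K w ^ 2 ≤
      omega (Z t) (a t) - m / 2 * charLength K (a t) ^ 2} := by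
    refine isClosed_le ?_ continuous_const
    exact (continuous_const.omega continuous_id).sub
      (continuous_const.mul ((continuous_charLength hcomp hne).pow 2))
  have := (TopologicalSpace.denseRange_denseSeq (PhaseSpace n)).closure_range ▸
    hclosed.closure_subset_iff.2 (range_subset_iff.2 ht)
  exact this (mem_univ w)

theorem eq_zero_of_forall_mul_le {δ c : ℝ} (hc : 0 ≤ c)
    (h : ∀ s : ℝ, |s| ≤ 1 → s * δ ≤ s ^ 2 * c) : δ = 0 := by
  set N := c + |δ| + 1
  have hδ := abs_nonneg δ
  have hN : 0 < N := by positivity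
  have h1 : |δ / N| ≤ 1 := by
    rw [abs_div, abs_of_pos hN, div_le_one hN]
    simp only [N]
    linarith
  have h2 := h _ h1
  rw [div_mul_eq_mul_div, div_pow, div_mul_eq_mul_div, div_le_div_iff₀ hN (by positivity)] at h2
  have h3 : δ * δ * N * (N - c) ≤ 0 := by nlinarith
  have h4 : 0 < N * (N - c) := mul_pos hN (by simp only [N]; linarith)
  have h5 : δ * δ ≤ 0 := by
    by_contra! hpos
    nlinarith [mul_pos hpos h4]
  exact mul_self_eq_zero.1 (le_antisymm h5 (mul_self_nonneg δ))

/-- Varying the scale of `a` gives the Euler relation. Testing multiples of an arbitrary `w` and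
optimizing the factor bounds $\omega(z,w)$, which by polarity bounds the gauge; testing at `a` gives
the reverse bound. -/
theorem omega_eq_and_gauge_eq_of_forall_le (hconv : Convex ℝ K) (hcomp : IsCompact K)
    (h0 : (0 : PhaseSpace n) ∈ interior K) {m : ℝ} (hm : 0 < m) {z a : PhaseSpace n}
    (h : ∀ w, omega z w - m / 2 * charLength K w ^ 2 ≤
      omega z a - m / 2 * charLength K a ^ 2) :
    omega z a = m * charLength K a ^ 2 ∧ gauge K z = m * charLength K a := by
  have h0K := interior_subset h0
  have hne : K.Nonempty := ⟨0, h0K⟩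
  have hY := charLength_nonneg hcomp h0K a
  have h1 : omega z a = m * charLength K a ^ 2 := by
    have : omega z a - m * charLength K a ^ 2 = 0 := by
      refine eq_zero_of_forall_mul_le (c := m / 2 * charLength K a ^ 2) (by positivity)
        fun s hs => ?_
      have h2 := h ((1 + s) • a)
      rw [charLength_smul hcomp hne (by linarith [(abs_le.1 hs).1]), omega_smul_right] at h2
      linarith
    linarith
  have h2 : ∀ w, omega z w ≤ m * charLength K a * charLength K w := by
    intro w
    have hX := charLength_nonneg hcomp h0K w
    obtain ⟨r, hr, hrx⟩ := exists_mul_norm_le_charLength hcomp h0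
    have key : ∀ s : ℝ, 0 < s → s * omega z w ≤
        m / 2 * (s ^ 2 * charLength K w ^ 2 + charLength K a ^ 2) := by
      intro s hs
      have h3 := h (s • w)
      rw [charLength_smul hcomp hne hs.le, omega_smul_right] at h3
      linarith
    rcases hX.eq_or_lt with hX | hX
    · have : w = 0 := norm_le_zero_iff.1 (by
        have := hrx w
        rw [← hX] at this
        exact nonpos_of_mul_nonpos_right this hr)
      simp [this, omega_zero_right, charLength_zero hcomp hne]
    · rcases hY.eq_or_lt with hY | hY
      · rw [← hY, mul_zero, zero_mul]
        by_contra! hpos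
        have h3 := key (omega z w / (m * charLength K w ^ 2)) (by positivity)
        rw [← hY] at h3
        field_simp at h3
        nlinarith
      · have h3 := key (charLength K a / charLength K w) (by positivity)
        rw [div_mul_eq_mul_div, div_le_iff₀ hX, div_pow, div_mul_cancel₀ _ (by positivity)] at h3
        refine le_of_mul_le_mul_left ?_ hY
        linarith
  refine ⟨h1, le_antisymm (gauge_le_of_forall_omega_le hconv hcomp h0 (by positivity) h2) ?_⟩
  rcases hY.eq_or_lt with hY | hY
  · rw [← hY, mul_zero]
    exact gauge_nonneg _
  · have h3 := omega_le_gauge_mul_charLength hconv hcomp h0 z a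
    rw [h1, pow_two, ← mul_assoc] at h3
    exact le_of_mul_le_mul_right h3 hY

theorem lipschitzOnWith_prim {x : ℝ → PhaseSpace n} (hx : IntervalIntegrable x volume 0 T)
    {C : NNReal} (hC : ∀ᵐ t ∂volume.restrict (Ioc 0 T), ‖x t‖ ≤ C) :
    LipschitzOnWith C (prim x) (Icc 0 T) := by
  refine LipschitzOnWith.of_dist_le_mul fun s hs t ht => ?_
  rw [dist_eq_norm, prim, prim, intervalIntegral.integral_interval_sub_left (hx.mono_right hs)
    (hx.mono_right ht), Real.dist_eq]
  refine intervalIntegral.norm_integral_le_of_norm_le_const_ae ?_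
  filter_upwards [(ae_restrict_iff' measurableSet_Ioc).1 hC] with r hr hrt
  refine hr ?_
  rw [uIoc_eq_union] at hrt
  rcases hrt with hrt | hrt
  · exact ⟨ht.1.trans_lt hrt.1, hrt.2.trans hs.2⟩
  · exact ⟨hs.1.trans_lt hrt.1, hrt.2.trans ht.2⟩

/-- Energy conservation without smoothness. For fixed $t$, the polar inequality with `w = x t` is an
equality at $s=t$, so the derivatives of both sides agree there; one of them is $\omega(x_t,x_t)=0$.
The second clause of `h` covers vanishing `charLength`, where the gauge is at its minimum. -/
theorem gauge_const_of_ae (hT : 0 ≤ T) (hconv : Convex ℝ K) (hcomp : IsCompact K)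
    (h0 : (0 : PhaseSpace n) ∈ interior K) {x : ℝ → PhaseSpace n}
    (hx : IntervalIntegrable x volume 0 T) {C : NNReal}
    (hC : ∀ᵐ t ∂volume.restrict (Ioc 0 T), ‖x t‖ ≤ C) (b : PhaseSpace n)
    (h : ∀ᵐ t ∂volume.restrict (Ioc 0 T),
      omega (b + prim x t) (x t) = gauge K (b + prim x t) * charLength K (x t) ∧
        (charLength K (x t) = 0 → gauge K (b + prim x t) = 0)) :
    ∃ ρ, ∀ t ∈ Icc 0 T, gauge K (b + prim x t) = ρ := by
  have hnhds := mem_interior_iff_mem_nhds.1 h0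
  obtain ⟨R, hR⟩ := hconv.lipschitz_gauge hnhds
  have hlip : LipschitzOnWith (R * (0 + C)) (fun t => gauge K (b + prim x t)) (uIcc 0 T) := by
    rw [uIcc_of_le hT]
    exact hR.comp_lipschitzOnWith
      ((LipschitzWith.const b).lipschitzOnWith.add (lipschitzOnWith_prim hx hC))
  have hac := hlip.absolutelyContinuousOnInterval
  rw [← uIcc_of_le hT]
  refine hac.const_of_ae_hasDerivAt_zero ?_
  have hne0 : ∀ᵐ t : ℝ, t ≠ 0 := by simp [ae_iff, measure_singleton]
  have hneT : ∀ᵐ t : ℝ, t ≠ T := by simp [ae_iff, measure_singleton]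
  filter_upwards [hac.boundedVariationOn.ae_differentiableAt_of_mem_uIcc,
    hx.ae_hasDerivAt_integral, (ae_restrict_iff' measurableSet_Ioc).1 h, hne0, hneT]
    with t hd hX ht ht0 htT htI
  have hd := (hd htI).hasDerivAt
  have hX : HasDerivAt (fun s => b + prim x s) (x t) t :=
    (hX htI 0 left_mem_uIcc).const_add b
  rw [uIcc_of_le hT] at htI
  have htI' : t ∈ Ioc 0 T := ⟨lt_of_le_of_ne htI.1 ht0.symm, htI.2⟩
  obtain ⟨h1, h2⟩ := ht htI'
  have hd0 : deriv (fun t => gauge K (b + prim x t)) t = 0 := by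
    by_cases he : charLength K (x t) = 0
    · refine IsLocalMin.deriv_eq_zero (Eventually.of_forall fun s => ?_)
      simp only [h2 he]
      exact gauge_nonneg _
    · have hF : HasDerivAt (fun s => gauge K (b + prim x s) * charLength K (x t) -
          omegaL.flip (x t) (b + prim x s))
          (deriv (fun t => gauge K (b + prim x t)) t * charLength K (x t) -
            omegaL.flip (x t) (x t)) t :=
        (hd.mul_const _).sub ((omegaL.flip (x t)).hasFDerivAt.comp_hasDerivAt t hX)
      have hmin : IsLocalMin (fun s => gauge K (b + prim x s) * charLength K (x t) -
          omegaL.flip (x t) (b + prim x s)) t := by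
        refine Eventually.of_forall fun s => ?_
        simp only [ContinuousLinearMap.flip_apply, omegaL_apply, h1, sub_self, sub_nonneg]
        exact omega_le_gauge_mul_charLength hconv hcomp h0 _ _
      have := hmin.hasDerivAt_eq_zero hF
      rw [ContinuousLinearMap.flip_apply, omegaL_apply, omega_self, sub_zero] at this
      exact (mul_eq_zero.1 this).resolve_right he
  rwa [hd0] at hd

theorem restrict_Icc_eq : volume.restrict (Icc (0 : ℝ) T) = volume.restrict (Ioc 0 T) :=
  (Measure.restrict_congr_set Ioc_ae_eq_Icc).symm

theorem action_nonneg (hcomp : IsCompact K) (h0 : (0 : PhaseSpace n) ∈ K)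
    {γ : ℝ → PhaseSpace n} (hγ : IsClosedCharacteristic K T γ) : 0 ≤ action T γ := by
  refine mul_nonneg (by norm_num) ?_
  rw [intervalIntegral.integral_of_le hγ.period_pos.le]
  refine integral_nonneg_of_ae ?_
  have := hγ.deriv_mem
  rw [restrict_Icc_eq] at this
  filter_upwards [this] with t ht
  exact (charLength_nonneg hcomp h0 _).trans
    ((neg_J_mem_normalCone_iff hcomp ⟨0, h0⟩ _ _).1 ht)

theorem cEHZ_nonneg (hcomp : IsCompact K) (h0 : (0 : PhaseSpace n) ∈ K) : 0 ≤ cEHZ K := by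
  refine Real.sInf_nonneg ?_
  rintro _ ⟨T, γ, hγ, rfl⟩
  exact action_nonneg hcomp h0 hγ

theorem cEHZ_le_action (hcomp : IsCompact K) (h0 : (0 : PhaseSpace n) ∈ K)
    {γ : ℝ → PhaseSpace n} (hγ : IsClosedCharacteristic K T γ) : cEHZ K ≤ action T γ := by
  refine csInf_le ⟨0, ?_⟩ ⟨T, γ, hγ, rfl⟩
  rintro _ ⟨T, γ, hγ, rfl⟩
  exact action_nonneg hcomp h0 hγ

/-- The translated primitive has constant gauge `ρ`. Divided by `ρ` it is a closed characteristic of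
action $T/(2m)$, with $m$ the maximal area, and the capacity is at most this action. -/
theorem two_mul_area_mul_cEHZ_le_of_maximizer (hT : 0 < T) (hconv : Convex ℝ K)
    (hcomp : IsCompact K) (h0 : (0 : PhaseSpace n) ∈ interior K) {a : L2 n T}
    (ha : a ∈ zeroMean n hT.le) (hnorm : lengthNorm K a = 1) (hpos : 0 < area T a a)
    (hmax : ∀ x ∈ zeroMean n hT.le, area T x x ≤ area T a a * lengthNorm K x ^ 2) :
    2 * area T a a * cEHZ K ≤ T := by
  have h0K := interior_subset h0
  have hne : K.Nonempty := ⟨0, h0K⟩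
  have hnhds := mem_interior_iff_mem_nhds.1 h0
  have ia := a.intervalIntegrable hT.le
  obtain ⟨b, hb⟩ := exists_lagrange_multiplier hT hcomp h0 ha hnorm hpos hmax
  set m := area T a a
  set Z : ℝ → PhaseSpace n := fun t => b + prim a t with hZdef
  have hZ : ContinuousOn Z (Icc 0 T) := by
    have := continuousOn_prim ia
    rw [uIcc_of_le hT.le] at this
    exact continuousOn_const.add this
  have haZ : ∫ t in Ioc 0 T, omega (Z t) (a t) = m := by
    rw [← intervalIntegral.integral_of_le hT.le, integral_omega_add_prim b ia ia,
      mem_zeroMean.1 ha, omega_zero_right, zero_add]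
  have hpt : ∀ᵐ t ∂volume.restrict (Ioc 0 T), omega (Z t) (a t) = m * charLength K (a t) ^ 2 ∧
      gauge K (Z t) = m * charLength K (a t) := by
    filter_upwards [ae_forall_omega_sub_le hT.le hcomp hne hZ hpos hnorm haZ hb] with t ht
    exact omega_eq_and_gauge_eq_of_forall_le hconv hcomp h0 hpos ht
  obtain ⟨r, hr, hrw⟩ := exists_mul_norm_le_charLength hcomp h0
  obtain ⟨B, hB⟩ := isCompact_Icc.exists_bound_of_continuousOn
    ((continuous_gauge hconv hnhds).comp_continuousOn hZ)
  have hC : ∀ᵐ t ∂volume.restrict (Ioc 0 T), ‖a t‖ ≤ (B / (m * r)).toNNReal := by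
    filter_upwards [hpt, ae_restrict_mem measurableSet_Ioc] with t ht htI
    refine le_trans ?_ (Real.le_coe_toNNReal _)
    rw [le_div_iff₀ (by positivity)]
    have h1 := (le_abs_self _).trans (hB t (Ioc_subset_Icc_self htI))
    rw [Function.comp_apply, ht.2] at h1
    have := mul_le_mul_of_nonneg_left (hrw (a t)) hpos.le
    linarith
  obtain ⟨ρ, hρ⟩ := gauge_const_of_ae hT.le hconv hcomp h0 ia hC b (by
    filter_upwards [hpt] with t ht
    refine ⟨?_, fun h => ?_⟩
    · rw [ht.1, ht.2]; ring
    · rw [ht.2, h, mul_zero])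
  have he : ∀ᵐ t ∂volume.restrict (Ioc 0 T), charLength K (a t) = ρ / m := by
    filter_upwards [hpt, ae_restrict_mem measurableSet_Ioc] with t ht htI
    rw [eq_div_iff hpos.ne', mul_comm, ← ht.2]
    exact hρ t (Ioc_subset_Icc_self htI)
  -- The constraint `lengthNorm K a = 1`, read off from the constant value `ρ / m` of `charLength`.
  have hTρ : T * ρ ^ 2 = m ^ 2 := by
    have h1 : lengthNorm K a ^ 2 = T * (ρ / m) ^ 2 := by
      rw [lengthNorm_sq]
      have : ∫ t in Ioc 0 T, charLength K (a t) ^ 2 = ∫ t in Ioc 0 T, (ρ / m) ^ 2 := by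
        refine integral_congr_ae ?_
        filter_upwards [he] with t ht
        rw [ht]
      rw [this]
      simp [hT.le]
    rw [hnorm] at h1
    field_simp at h1
    linarith
  have hρ0 : 0 < ρ := by
    have h1 : 0 ≤ ρ := by
      rw [← hρ 0 ⟨le_rfl, hT.le⟩]
      exact gauge_nonneg _
    refine h1.lt_of_ne ?_
    rintro rfl
    rw [zero_pow two_ne_zero, mul_zero] at hTρ
    exact (pow_pos hpos 2).ne hTρ
  set γ : ℝ → PhaseSpace n := fun t => ρ⁻¹ • Z t with hγdef
  have hderiv : ∀ᵐ t ∂volume.restrict (Ioc 0 T), deriv γ t = ρ⁻¹ • a t := by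
    filter_upwards [ae_restrict_of_ae ia.ae_hasDerivAt_integral,
      ae_restrict_mem measurableSet_Ioc] with t ht htI
    have h1 := ht (by rw [uIcc_of_le hT.le]; exact Ioc_subset_Icc_self htI) 0 left_mem_uIcc
    exact ((h1.const_add b).const_smul ρ⁻¹).deriv
  have hchar : IsClosedCharacteristic K T γ := by
    refine ⟨hT, ?_, ?_, ?_, ?_, ?_, ?_⟩
    · have hl := (LipschitzWith.const b).lipschitzOnWith.add (lipschitzOnWith_prim ia hC)
      have hs : LipschitzOnWith (‖ρ⁻¹‖₊ * (0 + (B / (m * r)).toNNReal)) γ (uIcc 0 T) := by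
        rw [uIcc_of_le hT.le]
        exact (lipschitzWith_smul ρ⁻¹).comp_lipschitzOnWith hl
      exact hs.absolutelyContinuousOnInterval
    · rw [restrict_Icc_eq]
      refine ((Lp.memLp a).const_smul ρ⁻¹).ae_eq ?_
      filter_upwards [hderiv] with t ht
      rw [ht, Pi.smul_apply]
    · intro t ht
      rw [← gauge_eq_one_iff_mem_frontier hconv hnhds, hγdef]
      simp only
      rw [gauge_smul_of_nonneg (by positivity), hρ t ht, smul_eq_mul, inv_mul_cancel₀ hρ0.ne']
    · simp only [hγdef, hZdef, mem_zeroMean.1 ha]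
      simp [prim]
    · rw [restrict_Icc_eq]
      filter_upwards [hderiv, hpt, he] with t h1 h2 h3
      rw [h1, neg_J_mem_normalCone_iff hcomp hne, charLength_smul hcomp hne (by positivity)]
      simp only [hγdef]
      rw [omega_smul_left, omega_smul_right, h2.1, h3]
      refine le_of_eq ?_
      field_simp
    · by_contra! hconst
      have h1 : ∀ t ∈ Icc 0 T, prim a t = 0 := by
        intro t ht
        have h2 := hconst t ht
        have h3 : prim a 0 = 0 := by simp [prim]
        simp only [hγdef, hZdef, h3, add_zero] at h2
        have h4 := smul_right_injective _ (inv_ne_zero hρ0.ne') h2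
        simpa using h4
      have h2 : area T a a = 0 := by
        rw [area, intervalIntegral.integral_congr (g := fun _ => (0 : ℝ))]
        · simp
        · intro t ht
          rw [uIcc_of_le hT.le] at ht
          simp only [h1 t ht, omega_zero_left]
      exact hpos.ne' h2
  have hact : action T γ = T / (2 * m) := by
    have h1 : ∫ t in (0 : ℝ)..T, omega (γ t) (deriv γ t) = ρ⁻¹ ^ 2 * m := by
      rw [intervalIntegral.integral_of_le hT.le, ← haZ, ← integral_const_mul]
      refine integral_congr_ae ?_
      filter_upwards [hderiv] with t ht
      rw [ht]
      simp only [hγdef]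
      rw [omega_smul_left, omega_smul_right]
      ring
    rw [action, h1]
    field_simp
    linarith
  have := cEHZ_le_action hcomp h0K hchar
  rw [hact, le_div_iff₀ (by positivity)] at this
  linarith

/-- The dual isoperimetric inequality: the capacity bounds the area enclosed by a loop in terms
of the length of its velocity field. -/
theorem two_mul_cEHZ_mul_area_le (hT : 0 < T) (hconv : Convex ℝ K)
    (hcomp : IsCompact K) (h0 : (0 : PhaseSpace n) ∈ interior K) {x : ℝ → PhaseSpace n}
    (hx : MemLp x 2 (volume.restrict (Ioc 0 T))) (hx0 : prim x T = 0) :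
    2 * cEHZ K * area T x x ≤ T * ∫ t in Ioc 0 T, charLength K (x t) ^ 2 := by
  have hc := cEHZ_nonneg hcomp (interior_subset h0)
  have hae := hx.coeFn_toLp
  have h1 : area T x x = area T hx.toLp hx.toLp := area_congr_ae hT.le hae.symm hae.symm
  have h2 : ∫ t in Ioc 0 T, charLength K (x t) ^ 2 = lengthNorm K hx.toLp ^ 2 := by
    rw [lengthNorm_sq]
    refine integral_congr_ae ?_
    filter_upwards [hae] with t ht
    rw [ht]
  have h3 : hx.toLp ∈ zeroMean n hT.le := by
    rw [mem_zeroMean, prim_congr_ae hae ⟨hT.le, le_rfl⟩, hx0]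
  rw [h1, h2]
  rcases le_or_gt (area T hx.toLp hx.toLp) 0 with hneg | hpos
  · exact (mul_nonpos_of_nonneg_of_nonpos (by positivity) hneg).trans (by positivity)
  · obtain ⟨a, ha, hnorm, hapos, hmax⟩ := exists_isoperimetric_maximizer hT.le hcomp h0 h3 hpos
    have h4 := two_mul_area_mul_cEHZ_le_of_maximizer hT hconv hcomp h0 ha hnorm hapos hmax
    calc 2 * cEHZ K * area T hx.toLp hx.toLp
        ≤ 2 * cEHZ K * (area T a a * lengthNorm K hx.toLp ^ 2) :=
          mul_le_mul_of_nonneg_left (hmax _ h3) (by positivity)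
      _ = 2 * area T a a * cEHZ K * lengthNorm K hx.toLp ^ 2 := by ring
      _ ≤ T * lengthNorm K hx.toLp ^ 2 := mul_le_mul_of_nonneg_right h4 (sq_nonneg _)

end CharDyn

/-! ### Polynomial profiles and the area of small loops. -/

namespace CharDyn

open Filter Topology Polynomial

theorem continuous_integral_sq_poly {N : ℕ} :
    Continuous fun c : Fin N → ℝ =>
      ∫ s in (0 : ℝ)..1, (∑ i : Fin N, c i * ((i : ℕ) + 1) * s ^ (i : ℕ)) ^ 2 := by
  refine intervalIntegral.continuous_parametric_intervalIntegral_of_continuous' ?_ _ _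
  change Continuous fun z : (Fin N → ℝ) × ℝ =>
    (∑ i : Fin N, z.1 i * ((i : ℕ) + 1) * z.2 ^ (i : ℕ)) ^ 2
  fun_prop

/-- In any linear subspace of finite codimension there is a polynomial, vanishing to second order
at `0` and `1`, with a lower bound on `∫ (q')²` that only depends on the codimension. -/
theorem exists_profile (W : Type*) [AddCommGroup W] [Module ℝ W] [FiniteDimensional ℝ W] :
    ∃ κ > 0, ∀ Λ : ℝ[X] →ₗ[ℝ] W, ∃ q : ℝ[X], Λ q = 0 ∧ q.eval 0 = 0 ∧ q.eval 1 = 0 ∧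
      q.derivative.eval 0 = 0 ∧ q.derivative.eval 1 = 0 ∧
      (∀ s ∈ Icc (0 : ℝ) 1, |q.derivative.eval s| ≤ 1 ∧ |q.derivative.derivative.eval s| ≤ 1) ∧
      κ ≤ ∫ s in (0 : ℝ)..1, q.derivative.eval s ^ 2 := by
  -- One more than the dimension of the target of `L` below: `Λ` and three endpoint conditions. The
  -- fourth, `q.eval 0 = 0`, is automatic because only positive powers occur.
  set N := Module.finrank ℝ W + 4 with hN
  have hN0 : (0 : ℝ) < N := by rw [hN]; positivity
  let P : (Fin N → ℝ) →ₗ[ℝ] ℝ[X] :=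
    ∑ i : Fin N, (Polynomial.monomial ((i : ℕ) + 1)).comp (LinearMap.proj i)
  have hP : ∀ c, P c = ∑ i : Fin N, Polynomial.monomial ((i : ℕ) + 1) (c i) := fun c => by
    simp [P]
  have hd : ∀ c s, (P c).derivative.eval s = ∑ i : Fin N, c i * ((i : ℕ) + 1) * s ^ (i : ℕ) := by
    intro c s
    rw [hP, Polynomial.derivative_sum, Polynomial.eval_finsetSum]
    refine Finset.sum_congr rfl fun i _ => ?_
    rw [Polynomial.derivative_monomial, Polynomial.eval_monomial]
    simp
  have hdd : ∀ c s, (P c).derivative.derivative.eval s =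
      ∑ i : Fin N, c i * ((i : ℕ) + 1) * (i : ℕ) * s ^ ((i : ℕ) - 1) := by
    intro c s
    rw [hP, Polynomial.derivative_sum, Polynomial.derivative_sum, Polynomial.eval_finsetSum]
    refine Finset.sum_congr rfl fun i _ => ?_
    rw [Polynomial.derivative_monomial, Polynomial.derivative_monomial, Polynomial.eval_monomial]
    simp
  let I : (Fin N → ℝ) → ℝ := fun c =>
    ∫ s in (0 : ℝ)..1, (∑ i : Fin N, c i * ((i : ℕ) + 1) * s ^ (i : ℕ)) ^ 2
  have hIpos : ∀ c, c ≠ 0 → 0 < I c := by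
    intro c hc
    refine intervalIntegral.integral_pos zero_lt_one (by fun_prop) (fun _ _ => sq_nonneg _) ?_
    by_contra! hneg
    have hz : (P c).derivative = 0 := by
      refine Polynomial.eq_zero_of_infinite_isRoot _ ((Icc_infinite zero_lt_one).mono fun s hs => ?_)
      have := hneg s hs
      rw [← hd] at this
      exact pow_eq_zero_iff two_ne_zero |>.1 (le_antisymm this (sq_nonneg _))
    refine hc (funext fun i => ?_)
    have h1 := congrArg (fun r : ℝ[X] => r.coeff (i : ℕ)) hz
    simp only [Polynomial.coeff_derivative, hP, Polynomial.finsetSum_coeff,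
      Polynomial.coeff_monomial, Polynomial.coeff_zero, Nat.add_right_cancel_iff, Fin.val_inj,
      Finset.sum_ite_eq', Finset.mem_univ, if_true] at h1
    refine (mul_eq_zero.1 h1).resolve_right ?_
    positivity
  have hsne : (Metric.sphere (0 : Fin N → ℝ) 1).Nonempty := by
    have : Nonempty (Fin N) := ⟨⟨0, by omega⟩⟩
    exact NormedSpace.sphere_nonempty.2 zero_le_one
  -- The bound is a minimum over the whole unit sphere of coefficients, hence independent of `Λ`.
  obtain ⟨c₀, hc₀, hmin⟩ := (isCompact_sphere (0 : Fin N → ℝ) 1).exists_isMinOn hsne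
    continuous_integral_sq_poly.continuousOn
  have hc₀0 : c₀ ≠ 0 := by
    rintro rfl
    simp at hc₀
  -- There are `N` terms, each multiplied by at most `N * N` after two differentiations; dividing by
  -- `D` bounds both derivatives by one.
  set D : ℝ := N * (N * N) with hD
  have hD0 : 0 < D := by positivity
  refine ⟨I c₀ / D ^ 2, div_pos (hIpos _ hc₀0) (by positivity), fun Λ => ?_⟩
  let ev : ℝ → ℝ[X] →ₗ[ℝ] ℝ := fun s => Polynomial.leval s
  let L : (Fin N → ℝ) →ₗ[ℝ] W × ℝ × ℝ × ℝ :=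
    (Λ.prod ((ev 1).prod (((ev 0).comp Polynomial.derivative).prod
      ((ev 1).comp Polynomial.derivative)))).comp P
  have hker : LinearMap.ker L ≠ ⊥ := by
    refine LinearMap.ker_ne_bot_of_finrank_lt ?_
    simp only [Module.finrank_prod, Module.finrank_self, Module.finrank_fin_fun]
    omega
  obtain ⟨c, hcL, hc⟩ := Submodule.exists_mem_ne_zero_of_ne_bot hker
  have hcn : 0 < ‖c‖ := norm_pos_iff.2 hc
  set e : Fin N → ℝ := ‖c‖⁻¹ • c with he
  have hen : ‖e‖ = 1 := by
    rw [he, norm_smul, norm_inv, norm_norm, inv_mul_cancel₀ hcn.ne']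
  have hLe : L (D⁻¹ • e) = 0 := by
    rw [he, map_smul, map_smul, LinearMap.mem_ker.1 hcL, smul_zero, smul_zero]
  have hcoef : ∀ i, |(D⁻¹ • e) i| ≤ D⁻¹ := fun i => by
    rw [Pi.smul_apply, smul_eq_mul, abs_mul, abs_of_pos (inv_pos.2 hD0)]
    exact mul_le_of_le_one_right (inv_pos.2 hD0).le ((norm_le_pi_norm e i).trans hen.le)
  have hL' : Λ (P (D⁻¹ • e)) = 0 ∧ (P (D⁻¹ • e)).eval 1 = 0 ∧
      (P (D⁻¹ • e)).derivative.eval 0 = 0 ∧ (P (D⁻¹ • e)).derivative.eval 1 = 0 := by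
    simpa [L, ev, Polynomial.leval] using hLe
  have hbd : ∀ (f : Fin N → ℝ), (∀ i, |f i| ≤ D⁻¹ * (N * N)) → |∑ i, f i| ≤ 1 := by
    intro f hf
    refine (Finset.abs_sum_le_sum_abs _ _).trans ((Finset.sum_le_sum fun i _ => hf i).trans ?_)
    rw [Finset.sum_const, Finset.card_univ, Fintype.card_fin, nsmul_eq_mul, hD]
    field_simp
    exact le_rfl
  have hi1 : ∀ i : Fin N, ((i : ℕ) : ℝ) + 1 ≤ N := fun i => by exact_mod_cast i.2
  have hN1 : (1 : ℝ) ≤ N := by rw [hN]; push_cast; linarith [Nat.cast_nonneg (α := ℝ) (Module.finrank ℝ W)]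
  refine ⟨P (D⁻¹ • e), hL'.1, ?_, hL'.2.1, hL'.2.2.1, hL'.2.2.2, fun s hs => ⟨?_, ?_⟩, ?_⟩
  · rw [hP, Polynomial.eval_finsetSum]
    simp
  · rw [hd]
    refine hbd _ fun i => ?_
    have hs1 : |s ^ (i : ℕ)| ≤ 1 := by
      rw [abs_of_nonneg (pow_nonneg hs.1 _)]
      exact pow_le_one₀ hs.1 hs.2
    have h2 : |((i : ℕ) : ℝ) + 1| ≤ N * N := by
      rw [abs_of_nonneg (by positivity)]
      nlinarith [hi1 i]
    rw [abs_mul, abs_mul]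
    exact (mul_le_of_le_one_right (by positivity) hs1).trans
      (mul_le_mul (hcoef i) h2 (abs_nonneg _) (inv_pos.2 hD0).le)
  · rw [hdd]
    refine hbd _ fun i => ?_
    have hs1 : |s ^ ((i : ℕ) - 1)| ≤ 1 := by
      rw [abs_of_nonneg (pow_nonneg hs.1 _)]
      exact pow_le_one₀ hs.1 hs.2
    have h2 : |(((i : ℕ) : ℝ) + 1) * (i : ℕ)| ≤ N * N := by
      rw [abs_of_nonneg (by positivity)]
      exact mul_le_mul (hi1 i) (by linarith [hi1 i]) (by positivity) hN0.le
    rw [mul_assoc (_ * _), mul_assoc, ← mul_assoc _ _ (s ^ _), abs_mul, abs_mul]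
    refine (mul_le_mul_of_nonneg_left (mul_le_of_le_one_right (abs_nonneg _) hs1)
      (abs_nonneg _)).trans ?_
    exact mul_le_mul (hcoef i) h2 (abs_nonneg _) (inv_pos.2 hD0).le
  · have h1 : I c₀ ≤ I e := hmin (by simpa using hen)
    have h2 : ∫ s in (0 : ℝ)..1, (P (D⁻¹ • e)).derivative.eval s ^ 2 = I e / D ^ 2 := by
      rw [div_eq_inv_mul, ← inv_pow, ← intervalIntegral.integral_const_mul]
      refine intervalIntegral.integral_congr fun s _ => ?_
      simp only [map_smul, Polynomial.eval_smul, smul_eq_mul, mul_pow,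
        hd]
    rw [h2]
    exact div_le_div_of_nonneg_right h1 (by positivity)

variable {n : ℕ} {T α β : ℝ}

/-- The velocity on `(α, β]` obtained by rescaling the planar loop `s ↦ (q'(s), q(s))`. -/
noncomputable def profileVel (α β : ℝ) (q : ℝ[X]) (u v : PhaseSpace n) (t : ℝ) : PhaseSpace n :=
  q.derivative.derivative.eval ((t - α) / (β - α)) • u +
    q.derivative.eval ((t - α) / (β - α)) • v

theorem continuous_profileVel {q : ℝ[X]} {u v : PhaseSpace n} :
    Continuous (profileVel α β q u v) := by
  unfold profileVel
  fun_prop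

theorem integral_profileVel (hαβ : α < β) {q : ℝ[X]} (h0 : q.eval 0 = 0)
    (hd0 : q.derivative.eval 0 = 0) (u v : PhaseSpace n) (t : ℝ) :
    ∫ s in α..t, profileVel α β q u v s = (β - α) •
      (q.derivative.eval ((t - α) / (β - α)) • u + q.eval ((t - α) / (β - α)) • v) := by
  have hε : β - α ≠ 0 := (sub_pos.2 hαβ).ne'
  have hlin : ∀ s, HasDerivAt (fun s => (s - α) / (β - α)) (1 / (β - α)) s := fun s =>
    ((hasDerivAt_id s).sub_const α).div_const _
  have hder : ∀ s, HasDerivAt (fun s => (β - α) •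
      (q.derivative.eval ((s - α) / (β - α)) • u + q.eval ((s - α) / (β - α)) • v))
      (profileVel α β q u v s) s := by
    intro s
    have h1 := ((q.derivative.hasDerivAt ((s - α) / (β - α))).comp s (hlin s)).smul_const u
    have h2 := ((q.hasDerivAt ((s - α) / (β - α))).comp s (hlin s)).smul_const v
    refine ((h1.add h2).const_smul (β - α)).congr_deriv ?_
    rw [profileVel, smul_add, smul_smul, smul_smul]
    congr 2 <;> field_simp
  rw [intervalIntegral.integral_eq_sub_of_hasDerivAt (fun s _ => hder s)
    (continuous_profileVel.intervalIntegrable _ _)]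
  simp [h0, hd0]

/-- The area density is $\omega(u,v)(q'^2-qq'')$ up to scaling, and integration by parts turns
$-qq''$ into a second $q'^2$. -/
theorem area_indicator_profileVel (hα : 0 ≤ α) (hαβ : α < β) (hβ : β ≤ T) {q : ℝ[X]}
    (h0 : q.eval 0 = 0) (h1 : q.eval 1 = 0) (hd0 : q.derivative.eval 0 = 0)
    (u v : PhaseSpace n) :
    area T ((Ioc α β).indicator (profileVel α β q u v))
      ((Ioc α β).indicator (profileVel α β q u v)) =
      2 * (β - α) ^ 2 * omega u v * ∫ s in (0 : ℝ)..1, q.derivative.eval s ^ 2 := by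
  have hε : β - α ≠ 0 := (sub_pos.2 hαβ).ne'
  have hT : 0 ≤ T := hα.trans (hαβ.le.trans hβ)
  have hprim : ∀ t ∈ Ioc α β, prim ((Ioc α β).indicator (profileVel α β q u v)) t =
      ∫ s in α..t, profileVel α β q u v s := by
    intro t ht
    rw [prim, intervalIntegral.integral_of_le (hα.trans ht.1.le),
      intervalIntegral.integral_of_le ht.1.le, setIntegral_indicator measurableSet_Ioc,
      Ioc_inter_Ioc, sup_eq_right.2 hα, inf_eq_left.2 ht.2]
  have hpt : ∀ t, omega (prim ((Ioc α β).indicator (profileVel α β q u v)) t)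
      ((Ioc α β).indicator (profileVel α β q u v) t) =
      (Ioc α β).indicator (fun t => (β - α) * omega u v *
        (fun s => q.derivative.eval s ^ 2 - q.eval s * q.derivative.derivative.eval s)
          (t / (β - α) - α / (β - α))) t := by
    intro t
    by_cases ht : t ∈ Ioc α β
    · rw [indicator_of_mem ht, indicator_of_mem ht, hprim t ht,
        integral_profileVel hαβ h0 hd0, profileVel, ← sub_div]
      simp only [omega_smul_left, omega_smul_right, omega_add_left, omega_add_right, omega_self,
        omega_swap u v]
      ring
    · rw [indicator_of_notMem ht, indicator_of_notMem ht, omega_zero_right]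
  have hbyparts : ∫ s in (0 : ℝ)..1, (q.derivative.eval s ^ 2 -
      q.eval s * q.derivative.derivative.eval s) =
      2 * ∫ s in (0 : ℝ)..1, q.derivative.eval s ^ 2 := by
    have hF : ∫ s in (0 : ℝ)..1, (q.derivative.eval s * q.derivative.eval s +
        q.eval s * q.derivative.derivative.eval s) = 0 := by
      rw [intervalIntegral.integral_eq_sub_of_hasDerivAt
        (f := fun s => q.eval s * q.derivative.eval s)
        (fun s _ => (q.hasDerivAt s).mul (q.derivative.hasDerivAt s))
        (Continuous.intervalIntegrable (by fun_prop) _ _), h0, h1]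
      ring
    have hA : ∫ s in (0 : ℝ)..1, (q.derivative.eval s ^ 2 -
        q.eval s * q.derivative.derivative.eval s) =
        (∫ s in (0 : ℝ)..1, 2 * q.derivative.eval s ^ 2) -
          ∫ s in (0 : ℝ)..1, (q.derivative.eval s * q.derivative.eval s +
            q.eval s * q.derivative.derivative.eval s) := by
      rw [← intervalIntegral.integral_sub (Continuous.intervalIntegrable (by fun_prop) _ _)
        (Continuous.intervalIntegrable (by fun_prop) _ _)]
      refine intervalIntegral.integral_congr fun s _ => ?_
      ring
    rw [hA, hF, sub_zero, intervalIntegral.integral_const_mul]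
  rw [area]
  simp only [hpt]
  rw [intervalIntegral.integral_of_le hT, setIntegral_indicator measurableSet_Ioc,
    Ioc_inter_Ioc, sup_eq_right.2 hα, inf_eq_right.2 hβ, ← intervalIntegral.integral_of_le hαβ.le,
    intervalIntegral.integral_const_mul, intervalIntegral.integral_comp_div_sub
      (fun s => q.derivative.eval s ^ 2 - q.eval s * q.derivative.derivative.eval s) hε, sub_self,
    ← sub_div, div_self hε, hbyparts, smul_eq_mul]
  ring

theorem abs_area_sub_area_le (hT : 0 ≤ T) {x y : ℝ → PhaseSpace n}
    (hx : IntervalIntegrable x volume 0 T) (hy : IntervalIntegrable y volume 0 T) :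
    |area T x x - area T y y| ≤ (∫ t in (0 : ℝ)..T, ‖x t - y t‖) *
      ((∫ t in (0 : ℝ)..T, ‖x t‖) + ∫ t in (0 : ℝ)..T, ‖y t‖) := by
  have hxy := hx.sub hy
  have e1 : area T x x = area T (fun t => x t - y t) x + area T y x := by
    rw [← area_add_left hT hxy hy hx]
    simp
  have e2 : area T y x = area T y (fun t => x t - y t) + area T y y := by
    rw [← area_add_right hxy hy hy]
    simp
  have h1 := abs_area_le hT hxy hx
  have h2 := abs_area_le hT hy hxy
  rw [e1, e2, add_sub_assoc, add_sub_cancel_right]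
  refine (abs_add_le _ _).trans ?_
  rw [mul_add]
  refine add_le_add h1 (h2.trans_eq (mul_comm _ _))

end CharDyn

/-! ### Perturbing an equality case along almost flat directions. -/

namespace CharDyn

open Filter Topology Polynomial

variable {n : ℕ} {T : ℝ} {K : Set (PhaseSpace n)}

/-- Pairs of directions along which the velocity `y` at the point `z` can be perturbed with a
first-order cost less than `θ`. -/
def almostFlat (K : Set (PhaseSpace n)) (z y : PhaseSpace n) (θ : ℝ) :
    Set (PhaseSpace n × PhaseSpace n) :=
  {w | (|omega z w.1| < θ ∧ |omega z w.2| < θ) ∧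
    (charLength K (y + w.1 + w.2) < 2 + θ ∧ charLength K (y + w.1 - w.2) < 2 + θ) ∧
    (charLength K (y - w.1 + w.2) < 2 + θ ∧ charLength K (y - w.1 - w.2) < 2 + θ)}

/-- Openness allows directions to be taken from a countable dense set; this is why the defining
inequalities are strict. -/
theorem isOpen_almostFlat (hcomp : IsCompact K) (hne : K.Nonempty) (z y : PhaseSpace n) (θ : ℝ) :
    IsOpen (almostFlat K z y θ) := by
  have he := continuous_charLength hcomp hne
  have hz : Continuous fun v : PhaseSpace n => omega z v := continuous_const.omega continuous_id
  have hlt : ∀ {f : PhaseSpace n × PhaseSpace n → ℝ} {c : ℝ}, Continuous f → IsOpen {w | f w < c} :=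
    fun hf => isOpen_lt hf continuous_const
  refine ((hlt ?_).inter (hlt ?_)).inter
    (((hlt ?_).inter (hlt ?_)).inter ((hlt ?_).inter (hlt ?_)))
  all_goals fun_prop

theorem measurableSet_mem_almostFlat (hcomp : IsCompact K) (hne : K.Nonempty)
    {g x : ℝ → PhaseSpace n} (hg : Measurable g) (hx : Measurable x)
    (w : PhaseSpace n × PhaseSpace n) (θ : ℝ) :
    MeasurableSet {t | w ∈ almostFlat K (g t) (x t) θ} := by
  have he := (continuous_charLength hcomp hne).measurable
  have hz : ∀ v : PhaseSpace n, Measurable fun t => |omega (g t) v| := fun v =>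
    ((continuous_id.omega continuous_const).measurable.comp hg).abs
  have hlen : ∀ {f : ℝ → PhaseSpace n}, Measurable f → Measurable fun t => charLength K (f t) :=
    fun hf => he.comp hf
  refine ((measurableSet_lt (hz _) measurable_const).inter
    (measurableSet_lt (hz _) measurable_const)).inter
    (((measurableSet_lt (hlen ?_) measurable_const).inter
      (measurableSet_lt (hlen ?_) measurable_const)).inter
      ((measurableSet_lt (hlen ?_) measurable_const).inter
      (measurableSet_lt (hlen ?_) measurable_const)))
  all_goals fun_prop

/-- Convexity on the parallelogram with these four corners, with the bilinear interpolation weights.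
-/
theorem charLength_add_smul_add_smul_le (hcomp : IsCompact K) (hne : K.Nonempty)
    {y u v : PhaseSpace n} {c : ℝ} (h1 : charLength K (y + u + v) ≤ c)
    (h2 : charLength K (y + u - v) ≤ c) (h3 : charLength K (y - u + v) ≤ c)
    (h4 : charLength K (y - u - v) ≤ c) {a b : ℝ} (ha : |a| ≤ 1) (hb : |b| ≤ 1) :
    charLength K (y + (a • u + b • v)) ≤ c := by
  obtain ⟨ha1, ha2⟩ := abs_le.1 ha
  obtain ⟨hb1, hb2⟩ := abs_le.1 hb
  have k1 : 0 ≤ (1 + a) * (1 + b) / 4 := by nlinarith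
  have k2 : 0 ≤ (1 + a) * (1 - b) / 4 := by nlinarith
  have k3 : 0 ≤ (1 - a) * (1 + b) / 4 := by nlinarith
  have k4 : 0 ≤ (1 - a) * (1 - b) / 4 := by nlinarith
  have heq : y + (a • u + b • v) =
      ((1 + a) * (1 + b) / 4) • (y + u + v) + ((1 + a) * (1 - b) / 4) • (y + u - v) +
      ((1 - a) * (1 + b) / 4) • (y - u + v) + ((1 - a) * (1 - b) / 4) • (y - u - v) := by
    module
  rw [heq]
  refine (charLength_add_le hcomp hne _ _).trans ?_
  refine (add_le_add_left (charLength_add_le hcomp hne _ _) _).trans ?_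
  refine (add_le_add_left (add_le_add_left (charLength_add_le hcomp hne _ _) _) _).trans ?_
  rw [charLength_smul hcomp hne k1, charLength_smul hcomp hne k2, charLength_smul hcomp hne k3,
    charLength_smul hcomp hne k4]
  nlinarith [mul_le_mul_of_nonneg_left h1 k1, mul_le_mul_of_nonneg_left h2 k2,
    mul_le_mul_of_nonneg_left h3 k3, mul_le_mul_of_nonneg_left h4 k4]

/-- Take the first member of a dense sequence that works. Off `E` the default `w₀` keeps the
selection in the ball. -/
theorem exists_measurable_selection (hcomp : IsCompact K) (hne : K.Nonempty)
    {g x : ℝ → PhaseSpace n} (hg : Measurable g) (hx : Measurable x)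
    (w₀ : PhaseSpace n × PhaseSpace n) {η θ : ℝ} (hη : 0 < η) {E : Set ℝ} (hE : MeasurableSet E)
    (h : ∀ t ∈ E, (Metric.ball w₀ η ∩ almostFlat K (g t) (x t) θ).Nonempty) :
    ∃ w : ℝ → PhaseSpace n × PhaseSpace n, Measurable w ∧ (∀ t, w t ∈ Metric.ball w₀ η) ∧
      ∀ t ∈ E, w t ∈ almostFlat K (g t) (x t) θ := by
  classical
  set q := TopologicalSpace.denseSeq (PhaseSpace n × PhaseSpace n)
  let p : ℝ → ℕ → Prop := fun t j =>
    t ∈ E → q j ∈ Metric.ball w₀ η ∧ q j ∈ almostFlat K (g t) (x t) θ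
  have hp : ∀ t, ∃ j, p t j := by
    intro t
    by_cases ht : t ∈ E
    · have hopen := (Metric.isOpen_ball (x := w₀) (ε := η)).inter (isOpen_almostFlat hcomp hne (g t) (x t) θ)
      obtain ⟨_, hj, j, rfl⟩ :=
        (TopologicalSpace.denseRange_denseSeq (PhaseSpace n × PhaseSpace n)).inter_open_nonempty
          _ hopen (h t ht)
      exact ⟨j, fun _ => hj⟩
    · exact ⟨0, fun ht' => absurd ht' ht⟩
  have hm : ∀ j, MeasurableSet {t | p t j} := by
    intro j
    have : {t | p t j} = Eᶜ ∪ ({t | q j ∈ Metric.ball w₀ η} ∩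
        {t | q j ∈ almostFlat K (g t) (x t) θ}) := by
      ext t
      simp only [p, mem_ofPred_eq, mem_union, mem_compl_iff, mem_inter_iff]
      tauto
    rw [this]
    exact hE.compl.union ((MeasurableSet.const _).inter
      (measurableSet_mem_almostFlat hcomp hne hg hx _ _))
  have hfind := measurable_find hp hm
  refine ⟨E.piecewise (fun t => q (Nat.find (hp t))) fun _ => w₀,
    Measurable.piecewise hE (measurable_from_nat.comp hfind) measurable_const, fun t => ?_,
    fun t ht => ?_⟩
  · by_cases ht : t ∈ E
    · rw [piecewise_eq_of_mem _ _ _ ht]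
      exact (Nat.find_spec (hp t) ht).1
    · rw [piecewise_eq_of_notMem _ _ _ ht]
      exact Metric.mem_ball_self hη
  · rw [piecewise_eq_of_mem _ _ _ ht]
    exact (Nat.find_spec (hp t) ht).2

/-- The first-order part of the comparison with a perturbed loop. -/
theorem area_le_of_isoperimetric (hT : 0 < T) (hcomp : IsCompact K)
    (h0 : (0 : PhaseSpace n) ∈ K)
    (hiso : ∀ y : ℝ → PhaseSpace n, MemLp y 2 (volume.restrict (Ioc 0 T)) → prim y T = 0 →
      2 * area T y y ≤ ∫ t in Ioc 0 T, charLength K (y t) ^ 2)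
    {x φ : ℝ → PhaseSpace n} (hx : MemLp x 2 (volume.restrict (Ioc 0 T))) (hx0 : prim x T = 0)
    (harea : area T x x = 2 * T) (hφ : MemLp φ 2 (volume.restrict (Ioc 0 T)))
    (hφ0 : prim φ T = 0) (b : PhaseSpace n) {θ : ℝ} (hθ0 : 0 ≤ θ) (hθ1 : θ ≤ 1)
    (hlen : ∀ᵐ t ∂volume.restrict (Ioc 0 T), charLength K (x t + φ t) ≤ 2 + θ)
    (hflat : ∀ t ∈ Icc 0 T, -(2 * θ) ≤ omega (b + prim x t) (φ t)) :
    area T φ φ ≤ 7 * θ * T := by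
  have ix := memLp_intervalIntegrable hT.le hx
  have iφ := memLp_intervalIntegrable hT.le hφ
  have hp : prim (fun t => x t + φ t) T = 0 := by
    rw [prim_add ix iφ ⟨hT.le, le_rfl⟩, hx0, hφ0, add_zero]
  have h1 := hiso (fun t => x t + φ t) (hx.add hφ) hp
  have h2 : ∫ t in Ioc 0 T, charLength K (x t + φ t) ^ 2 ≤ T * (2 + θ) ^ 2 := by
    have : ∫ t in Ioc 0 T, charLength K (x t + φ t) ^ 2 ≤ ∫ t in Ioc 0 T, (2 + θ) ^ 2 := by
      refine integral_mono_of_nonneg (Eventually.of_forall fun _ => sq_nonneg _)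
        (integrable_const _) ?_
      filter_upwards [hlen] with t ht
      exact pow_le_pow_left₀ (charLength_nonneg hcomp h0 _) ht 2
    refine this.trans_eq ?_
    simp [hT.le]
  have h3 : area T (fun t => x t + φ t) (fun t => x t + φ t) =
      2 * T + 2 * area T x φ + area T φ φ := by
    rw [area_add_left hT.le ix iφ (ix.add iφ), area_add_right ix iφ ix, area_add_right ix iφ iφ,
      ← area_comm_of_left ix iφ hx0, harea]
    ring
  have h4 : -(2 * θ) * T ≤ area T x φ := by
    have e1 : area T x φ = ∫ t in (0 : ℝ)..T, omega (b + prim x t) (φ t) := by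
      rw [integral_omega_add_prim b ix iφ, hφ0, omega_zero_right, zero_add]
    have e2 : ∫ t in (0 : ℝ)..T, -(2 * θ) = -(2 * θ) * T := by
      rw [intervalIntegral.integral_const]
      simp [mul_comm]
    rw [e1, ← e2]
    exact intervalIntegral.integral_mono_on hT.le intervalIntegrable_const
      (intervalIntegrable_omega (continuousOn_const.add (continuousOn_prim ix)) iφ) hflat
  rw [h3] at h1
  -- The squared length costs at most $5\theta T$ and the linear term $8\theta T$; half of the sum
  -- is below $7\theta T$.
  nlinarith [mul_nonneg hθ0 hT.le, mul_nonneg (mul_nonneg hθ0 (sub_nonneg.2 hθ1)) hT.le]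

/-- The profile perturbation with variable directions, supported in a measurable set. -/
noncomputable def perturbation (α β : ℝ) (E : Set ℝ) (w : ℝ → PhaseSpace n × PhaseSpace n)
    (q : ℝ[X]) : ℝ → PhaseSpace n :=
  (Ioc α β).indicator (E.indicator fun t => profileVel α β q (w t).1 (w t).2 t)

theorem memLp_perturbation {α β : ℝ} {E : Set ℝ} (hE : MeasurableSet E)
    {w : ℝ → PhaseSpace n × PhaseSpace n} (hw : Measurable w) {w₀ : PhaseSpace n × PhaseSpace n}
    {η : ℝ} (hη : ∀ t, w t ∈ Metric.ball w₀ η) (q : ℝ[X]) :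
    MemLp (perturbation α β E w q) 2 (volume.restrict (Ioc 0 T)) := by
  have hc1 : Continuous fun t => q.derivative.derivative.eval ((t - α) / (β - α)) := by fun_prop
  have hc2 : Continuous fun t => q.derivative.eval ((t - α) / (β - α)) := by fun_prop
  obtain ⟨C1, hC1⟩ := (isCompact_Icc (a := α) (b := β)).exists_bound_of_continuousOn
    hc1.continuousOn
  obtain ⟨C2, hC2⟩ := (isCompact_Icc (a := α) (b := β)).exists_bound_of_continuousOn
    hc2.continuousOn
  have hmeas : Measurable (perturbation α β E w q) := by
    refine Measurable.indicator (Measurable.indicator ?_ hE) measurableSet_Ioc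
    exact (hc1.measurable.smul hw.fst).add (hc2.measurable.smul hw.snd)
  refine MemLp.of_bound hmeas.aestronglyMeasurable ((|C1| + |C2|) * (‖w₀‖ + η))
    (Eventually.of_forall fun t => ?_)
  have hwt : ‖w t‖ ≤ ‖w₀‖ + η := by
    have h1 := norm_le_norm_add_norm_sub' (w t) w₀
    have h2 := hη t
    rw [mem_ball_iff_norm] at h2
    linarith
  have hnn : 0 ≤ ‖w₀‖ + η := (norm_nonneg _).trans hwt
  unfold perturbation
  by_cases ht : t ∈ Ioc α β
  · rw [indicator_of_mem ht]
    refine (norm_indicator_le_norm_self _ _).trans ?_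
    unfold profileVel
    refine (norm_add_le _ _).trans ?_
    rw [norm_smul, norm_smul, add_mul]
    have hI := Ioc_subset_Icc_self ht
    exact add_le_add
      (mul_le_mul ((hC1 t hI).trans (le_abs_self _)) ((norm_fst_le _).trans hwt)
        (norm_nonneg _) (abs_nonneg _))
      (mul_le_mul ((hC2 t hI).trans (le_abs_self _)) ((norm_snd_le _).trans hwt)
        (norm_nonneg _) (abs_nonneg _))
  · rw [indicator_of_notMem ht, norm_zero]
    positivity

/-- The mean of the perturbation, as a linear function of the profile. -/
noncomputable def perturbationMean (hT : 0 ≤ T) (α β : ℝ) {E : Set ℝ} (hE : MeasurableSet E)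
    {w : ℝ → PhaseSpace n × PhaseSpace n} (hw : Measurable w) {w₀ : PhaseSpace n × PhaseSpace n}
    {η : ℝ} (hη : ∀ t, w t ∈ Metric.ball w₀ η) : ℝ[X] →ₗ[ℝ] PhaseSpace n where
  toFun q := prim (perturbation α β E w q) T
  map_add' p q := by
    rw [← prim_add (memLp_intervalIntegrable hT (memLp_perturbation hE hw hη p))
      (memLp_intervalIntegrable hT (memLp_perturbation hE hw hη q)) ⟨hT, le_rfl⟩]
    congr 1
    ext1 t
    by_cases h1 : t ∈ Ioc α β <;> by_cases h2 : t ∈ E <;>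
      simp only [perturbation, h1, h2, indicator_of_mem, indicator_of_notMem, not_false_eq_true,
        add_zero]
    simp only [profileVel, Polynomial.derivative_add, Polynomial.eval_add]
    module
  map_smul' a q := by
    rw [RingHom.id_apply, ← prim_smul]
    congr 1
    ext1 t
    by_cases h1 : t ∈ Ioc α β <;> by_cases h2 : t ∈ E <;>
      simp only [perturbation, h1, h2, indicator_of_mem, indicator_of_notMem, not_false_eq_true,
        smul_zero]
    simp only [profileVel, Polynomial.derivative_smul, Polynomial.eval_smul, smul_eq_mul]
    module

theorem div_mem_Icc {α β t : ℝ} (hαβ : α < β) (ht : t ∈ Ioc α β) :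
    (t - α) / (β - α) ∈ Icc (0 : ℝ) 1 :=
  ⟨div_nonneg (sub_nonneg.2 ht.1.le) (sub_nonneg.2 hαβ.le),
    (div_le_one (sub_pos.2 hαβ)).2 (sub_le_sub_right ht.2 _)⟩

theorem norm_profileVel_le {α β : ℝ} (hαβ : α < β) {q : ℝ[X]}
    (hq : ∀ s ∈ Icc (0 : ℝ) 1, |q.derivative.eval s| ≤ 1 ∧ |q.derivative.derivative.eval s| ≤ 1)
    (u v : PhaseSpace n) {t : ℝ} (ht : t ∈ Ioc α β) :
    ‖profileVel α β q u v t‖ ≤ ‖u‖ + ‖v‖ := by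
  obtain ⟨h1, h2⟩ := hq _ (div_mem_Icc hαβ ht)
  refine (norm_add_le _ _).trans ?_
  rw [norm_smul, norm_smul]
  exact add_le_add (mul_le_of_le_one_left (norm_nonneg _) h2)
    (mul_le_of_le_one_left (norm_nonneg _) h1)

/-- Compare with the perturbation whose directions are frozen at `w₀`, whose area is explicit. The
area is Lipschitz for the $L^1$ norm on bounded sets, and both fields have $L^1$ norm of order `β -
α`. -/
theorem le_area_perturbation {α β : ℝ} (hα : 0 ≤ α) (hαβ : α < β) (hβ : β ≤ T) {q : ℝ[X]}
    (h0 : q.eval 0 = 0) (h1 : q.eval 1 = 0) (hd0 : q.derivative.eval 0 = 0)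
    (hq : ∀ s ∈ Icc (0 : ℝ) 1, |q.derivative.eval s| ≤ 1 ∧ |q.derivative.derivative.eval s| ≤ 1)
    {E : Set ℝ} (hE : MeasurableSet E)
    {w : ℝ → PhaseSpace n × PhaseSpace n} (hw : Measurable w) {w₀ : PhaseSpace n × PhaseSpace n}
    {η : ℝ} (hη : ∀ t, w t ∈ Metric.ball w₀ η)
    (hdens : volume.real (Ioc α β \ E) * (‖w₀.1‖ + ‖w₀.2‖) ≤ (β - α) * η) :
    2 * (β - α) ^ 2 * omega w₀.1 w₀.2 * (∫ s in (0 : ℝ)..1, q.derivative.eval s ^ 2) -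
      (β - α) ^ 2 * (3 * η * (2 * (‖w₀.1‖ + ‖w₀.2‖) + 2 * η)) ≤
      area T (perturbation α β E w q) (perturbation α β E w q) := by
  have hT : 0 ≤ T := hα.trans (hαβ.le.trans hβ)
  have hε : 0 < β - α := sub_pos.2 hαβ
  set S := ‖w₀.1‖ + ‖w₀.2‖ with hS
  have hη0 : 0 ≤ η := (dist_nonneg.trans_lt (hη 0)).le
  set φ := perturbation α β E w q with hφ
  set φ₀ := (Ioc α β).indicator (profileVel α β q w₀.1 w₀.2) with hφ₀
  have iφ : IntervalIntegrable φ volume 0 T :=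
    memLp_intervalIntegrable hT (memLp_perturbation hE hw hη q)
  have iφ₀ : IntervalIntegrable φ₀ volume 0 T :=
    ⟨((continuous_profileVel.intervalIntegrable 0 T).1.indicator measurableSet_Ioc),
      ((continuous_profileVel.intervalIntegrable 0 T).2.indicator measurableSet_Ioc)⟩
  have hw1 : ∀ t, ‖(w t).1 - w₀.1‖ ≤ η := fun t => by
    have := (hη t)
    rw [mem_ball_iff_norm] at this
    exact (norm_fst_le (w t - w₀)).trans this.le
  have hw2 : ∀ t, ‖(w t).2 - w₀.2‖ ≤ η := fun t => by
    have := (hη t)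
    rw [mem_ball_iff_norm] at this
    exact (norm_snd_le (w t - w₀)).trans this.le
  have hind : ∀ (c : ℝ), ∫ t in (0 : ℝ)..T, (Ioc α β).indicator (fun _ => c) t = (β - α) * c := by
    intro c
    rw [intervalIntegral.integral_of_le hT, setIntegral_indicator measurableSet_Ioc,
      Ioc_inter_Ioc, sup_eq_right.2 hα, inf_eq_right.2 hβ]
    simp [hαβ.le]
  have iind : ∀ (c : ℝ) {A : Set ℝ}, MeasurableSet A →
      IntervalIntegrable (A.indicator fun _ => c) volume 0 T := fun c A hA =>
    ⟨(intervalIntegrable_const (a := 0) (b := T) (μ := volume) (c := c)).1.indicator hA,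
      (intervalIntegrable_const (a := 0) (b := T) (μ := volume) (c := c)).2.indicator hA⟩
  have b1 : ∫ t in (0 : ℝ)..T, ‖φ₀ t‖ ≤ (β - α) * S := by
    rw [← hind]
    refine intervalIntegral.integral_mono_on hT iφ₀.norm (iind _ measurableSet_Ioc) fun t _ => ?_
    by_cases ht : t ∈ Ioc α β
    · rw [hφ₀, indicator_of_mem ht, indicator_of_mem ht]
      exact norm_profileVel_le hαβ hq _ _ ht
    · rw [hφ₀, indicator_of_notMem ht, indicator_of_notMem ht, norm_zero]
  have b2 : ∫ t in (0 : ℝ)..T, ‖φ t‖ ≤ (β - α) * (S + 2 * η) := by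
    rw [← hind]
    refine intervalIntegral.integral_mono_on hT iφ.norm (iind _ measurableSet_Ioc) fun t _ => ?_
    by_cases ht : t ∈ Ioc α β
    · rw [hφ, perturbation, indicator_of_mem ht, indicator_of_mem ht]
      refine (norm_indicator_le_norm_self _ _).trans ((norm_profileVel_le hαβ hq _ _ ht).trans ?_)
      have e1 := norm_le_norm_add_norm_sub' (w t).1 w₀.1
      have e2 := norm_le_norm_add_norm_sub' (w t).2 w₀.2
      linarith [hw1 t, hw2 t]
    · rw [hφ, perturbation, indicator_of_notMem ht, indicator_of_notMem ht, norm_zero]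
  -- The variation of the two directions contributes `2 * η`, and the part of the interval outside
  -- `E` contributes `η` by `hdens`.
  have b3 : ∫ t in (0 : ℝ)..T, ‖φ t - φ₀ t‖ ≤ (β - α) * (3 * η) := by
    have hint : ∫ t in (0 : ℝ)..T, ((Ioc α β).indicator (fun _ => 2 * η) t +
        (Ioc α β \ E).indicator (fun _ => S) t) ≤ (β - α) * (3 * η) := by
      rw [intervalIntegral.integral_add (iind _ measurableSet_Ioc)
        (iind _ (measurableSet_Ioc.diff hE)), hind]
      have : ∫ t in (0 : ℝ)..T, (Ioc α β \ E).indicator (fun _ => S) t =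
          volume.real (Ioc α β \ E) * S := by
        rw [intervalIntegral.integral_of_le hT,
          setIntegral_indicator (measurableSet_Ioc.diff hE), inter_eq_right.2, setIntegral_const,
          smul_eq_mul]
        exact sdiff_subset.trans (Ioc_subset_Ioc hα hβ)
      rw [this]
      linarith
    refine le_trans ?_ hint
    refine intervalIntegral.integral_mono_on hT (iφ.sub iφ₀).norm
      ((iind _ measurableSet_Ioc).add (iind _ (measurableSet_Ioc.diff hE))) fun t _ => ?_
    by_cases ht : t ∈ Ioc α β
    · by_cases htE : t ∈ E
      · have hnot : t ∉ Ioc α β \ E := fun h => h.2 htE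
        rw [hφ, hφ₀, perturbation, indicator_of_mem ht, indicator_of_mem ht, indicator_of_mem ht,
          indicator_of_mem htE, indicator_of_notMem hnot]
        have : profileVel α β q (w t).1 (w t).2 t - profileVel α β q w₀.1 w₀.2 t =
            profileVel α β q ((w t).1 - w₀.1) ((w t).2 - w₀.2) t := by
          simp only [profileVel]
          module
        rw [this]
        have := norm_profileVel_le hαβ hq ((w t).1 - w₀.1) ((w t).2 - w₀.2) ht
        linarith [hw1 t, hw2 t]
      · have hmem : t ∈ Ioc α β \ E := ⟨ht, htE⟩
        rw [hφ, hφ₀, perturbation, indicator_of_mem ht, indicator_of_mem ht, indicator_of_mem ht,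
          indicator_of_notMem htE, indicator_of_mem hmem, zero_sub, norm_neg]
        have := norm_profileVel_le hαβ hq w₀.1 w₀.2 ht
        linarith
    · have hnot : t ∉ Ioc α β \ E := fun h => ht h.1
      rw [hφ, hφ₀, perturbation, indicator_of_notMem ht, indicator_of_notMem ht,
        indicator_of_notMem ht, indicator_of_notMem hnot]
      simp
  have h2 := abs_area_sub_area_le hT iφ iφ₀
  rw [hφ₀, area_indicator_profileVel hα hαβ hβ h0 h1 hd0, ← hφ₀] at h2
  have h3 : (∫ t in (0 : ℝ)..T, ‖φ t - φ₀ t‖) *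
      ((∫ t in (0 : ℝ)..T, ‖φ t‖) + ∫ t in (0 : ℝ)..T, ‖φ₀ t‖) ≤
      ((β - α) * (3 * η)) * ((β - α) * (S + 2 * η) + (β - α) * S) := by
    refine mul_le_mul b3 (add_le_add b2 b1) ?_ (by positivity)
    exact add_nonneg (intervalIntegral.integral_nonneg hT fun _ _ => norm_nonneg _)
      (intervalIntegral.integral_nonneg hT fun _ _ => norm_nonneg _)
  have h4 := (abs_le.1 (h2.trans h3)).1
  linarith

/-- If `E` filled the interval well enough, the perturbed loop would gain a fixed multiple of
$(\beta-\alpha)^2$ in area, while the isoperimetric inequality allows only $7\theta T$. The interval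
is fixed before $\theta$. The selection, and with it the mean to be killed, depends on $\theta$;
hence the need for `κ` uniform in `Λ`. -/
theorem not_dense_almostFlat (hT : 0 < T) (hcomp : IsCompact K) (h0 : (0 : PhaseSpace n) ∈ K)
    (hiso : ∀ y : ℝ → PhaseSpace n, MemLp y 2 (volume.restrict (Ioc 0 T)) → prim y T = 0 →
      2 * area T y y ≤ ∫ t in Ioc 0 T, charLength K (y t) ^ 2)
    {x : ℝ → PhaseSpace n} (hxm : Measurable x) (hx : MemLp x 2 (volume.restrict (Ioc 0 T)))
    (hx0 : prim x T = 0) (harea : area T x x = 2 * T)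
    (hlen : ∀ᵐ t ∂volume.restrict (Ioc 0 T), charLength K (x t) = 2) {b : PhaseSpace n}
    (hg : Measurable fun t => b + prim x t) {κ : ℝ}
    (hκ : ∀ Λ : ℝ[X] →ₗ[ℝ] PhaseSpace n, ∃ q : ℝ[X], Λ q = 0 ∧ q.eval 0 = 0 ∧ q.eval 1 = 0 ∧
      q.derivative.eval 0 = 0 ∧ q.derivative.eval 1 = 0 ∧
      (∀ s ∈ Icc (0 : ℝ) 1, |q.derivative.eval s| ≤ 1 ∧ |q.derivative.derivative.eval s| ≤ 1) ∧
      κ ≤ ∫ s in (0 : ℝ)..1, q.derivative.eval s ^ 2)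
    {w₀ : PhaseSpace n × PhaseSpace n} (hω : 0 ≤ omega w₀.1 w₀.2) {η : ℝ} (hη : 0 < η)
    (hR : 3 * η * (2 * (‖w₀.1‖ + ‖w₀.2‖) + 2 * η) < 2 * κ * omega w₀.1 w₀.2)
    {E : Set ℝ} (hE : MeasurableSet E)
    (hEflat : ∀ t ∈ E, ∀ m : ℕ,
      (Metric.ball w₀ η ∩ almostFlat K (b + prim x t) (x t) (1 / (m + 1))).Nonempty)
    {α β : ℝ} (hα : 0 ≤ α) (hαβ : α < β) (hβ : β ≤ T) :
    (β - α) * η < volume.real (Ioc α β \ E) * (‖w₀.1‖ + ‖w₀.2‖) := by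
  by_contra! hdens
  have hε : 0 < β - α := sub_pos.2 hαβ
  set R := 3 * η * (2 * (‖w₀.1‖ + ‖w₀.2‖) + 2 * η) with hRdef
  have hG : 0 < (β - α) ^ 2 * (2 * κ * omega w₀.1 w₀.2 - R) / (7 * T) :=
    div_pos (mul_pos (by positivity) (sub_pos.2 hR)) (by positivity)
  obtain ⟨m, hm⟩ := exists_nat_one_div_lt hG
  set θ : ℝ := 1 / (m + 1) with hθ
  have hθ0 : 0 ≤ θ := by positivity
  have hθ1 : θ ≤ 1 := by
    rw [hθ, div_le_one (by positivity)]
    linarith [Nat.cast_nonneg (α := ℝ) m]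
  obtain ⟨w, hwm, hwη, hwE⟩ := exists_measurable_selection hcomp ⟨0, h0⟩ hg hxm w₀ hη hE
    fun t ht => hEflat t ht m
  obtain ⟨q, hq, hq0, hq1, hqd0, -, hqb, hqκ⟩ := hκ (perturbationMean hT.le α β hE hwm hwη)
  have hφ0 : prim (perturbation α β E w q) T = 0 := hq
  have hpt : ∀ t, perturbation α β E w q t = 0 ∨ t ∈ E ∧ ∃ a b : ℝ, |a| ≤ 1 ∧ |b| ≤ 1 ∧
      perturbation α β E w q t = a • (w t).1 + b • (w t).2 := by
    intro t
    by_cases ht : t ∈ Ioc α β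
    · by_cases htE : t ∈ E
      · obtain ⟨e1, e2⟩ := hqb _ (div_mem_Icc hαβ ht)
        refine Or.inr ⟨htE, _, _, e2, e1, ?_⟩
        rw [perturbation, indicator_of_mem ht, indicator_of_mem htE, profileVel]
      · left
        rw [perturbation, indicator_of_mem ht, indicator_of_notMem htE]
    · left
      rw [perturbation, indicator_of_notMem ht]
  have h1 := area_le_of_isoperimetric hT hcomp h0 hiso hx hx0 harea
    (memLp_perturbation hE hwm hwη q) hφ0 b hθ0 hθ1 (by
      filter_upwards [hlen] with t ht
      rcases hpt t with h | ⟨htE, c, d, hc, hd, h⟩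
      · rw [h, add_zero, ht]
        linarith
      · obtain ⟨-, ⟨f1, f2⟩, f3, f4⟩ := hwE t htE
        rw [h]
        exact charLength_add_smul_add_smul_le hcomp ⟨0, h0⟩ f1.le f2.le f3.le f4.le hc hd) (by
      intro t _
      rcases hpt t with h | ⟨htE, c, d, hc, hd, h⟩
      · rw [h, omega_zero_right]
        linarith
      · obtain ⟨⟨f1, f2⟩, -⟩ := hwE t htE
        rw [h, omega_add_right, omega_smul_right, omega_smul_right]
        have g1 := mul_le_mul hc f1.le (abs_nonneg _) zero_le_one
        have g2 := mul_le_mul hd f2.le (abs_nonneg _) zero_le_one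
        rw [← abs_mul] at g1 g2
        linarith [(abs_le.1 g1).1, (abs_le.1 g2).1])
  have h2 := le_area_perturbation hα hαβ hβ hq0 hq1 hqd0 hqb hE hwm hwη hdens
  rw [lt_div_iff₀ (by positivity)] at hm
  have h3 : 2 * (β - α) ^ 2 * omega w₀.1 w₀.2 * κ ≤
      2 * (β - α) ^ 2 * omega w₀.1 w₀.2 * (∫ s in (0 : ℝ)..1, q.derivative.eval s ^ 2) :=
    mul_le_mul_of_nonneg_left hqκ (by positivity)
  linarith

/-- Lebesgue density, with intervals centred at a density point. -/
theorem ae_exists_dense_interval {E : Set ℝ} (hE : MeasurableSet E) :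
    ∀ᵐ t : ℝ, t ∈ E → ∀ a b : ℝ, t ∈ Ioo a b → ∀ δ > 0, ∃ α β : ℝ, a ≤ α ∧ α < β ∧ β ≤ b ∧
      volume.real (Ioc α β \ E) ≤ δ * (β - α) := by
  filter_upwards [Besicovitch.ae_tendsto_measure_inter_div_of_measurableSet volume hE]
    with t ht htE a b htab δ hδ
  rw [indicator_of_mem htE, Pi.one_apply] at ht
  have h1 := (ENNReal.tendsto_toReal ENNReal.one_ne_top).comp ht
  rw [ENNReal.toReal_one] at h1
  have h2 := h1.eventually (lt_mem_nhds (show 1 - δ < 1 by linarith))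
  have h3 : ∀ᶠ r in 𝓝[>] (0 : ℝ), r ≤ min (t - a) (b - t) :=
    nhdsWithin_le_nhds (Iic_mem_nhds (lt_min (sub_pos.2 htab.1) (sub_pos.2 htab.2)))
  obtain ⟨r, ⟨hr1, hr2⟩, hr0⟩ := ((h2.and h3).and self_mem_nhdsWithin).exists
  have hr0 : 0 < r := hr0
  have h4 := hr2.trans (min_le_left _ _)
  have h5 := hr2.trans (min_le_right _ _)
  refine ⟨t - r, t + r, by linarith, by linarith, by linarith, ?_⟩
  have h6 : volume.real (Metric.closedBall t r) = 2 * r := Real.volume_real_closedBall hr0.le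
  have h7 : (1 - δ) * (2 * r) ≤ volume.real (E ∩ Metric.closedBall t r) := by
    rw [Function.comp_apply, ENNReal.toReal_div] at hr1
    change 1 - δ < volume.real (E ∩ Metric.closedBall t r) / volume.real (Metric.closedBall t r)
      at hr1
    rw [h6, lt_div_iff₀ (by positivity)] at hr1
    exact hr1.le
  have h8 : volume.real (Metric.closedBall t r ∩ E) + volume.real (Metric.closedBall t r \ E) =
      volume.real (Metric.closedBall t r) :=
    measureReal_inter_add_sdiff hE measure_closedBall_lt_top.ne
  have h9 : volume.real (Ioc (t - r) (t + r) \ E) ≤ volume.real (Metric.closedBall t r \ E) := by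
    refine measureReal_mono (sdiff_subset_sdiff_left ?_)
      ((measure_mono sdiff_subset).trans_lt measure_closedBall_lt_top).ne
    rw [Real.closedBall_eq_Icc]
    exact Ioc_subset_Icc_self
  rw [inter_comm] at h8
  linarith

/-- The curve stays in $K$ near $t$, so $s\mapsto\omega(\gamma(s),w)$ has a local maximum at $t$. -/
theorem omega_eq_zero_of_hasDerivAt (hcomp : IsCompact K) {γ : ℝ → PhaseSpace n} {t : ℝ}
    {y : PhaseSpace n} (hγ : HasDerivAt γ y t) (hK : ∀ᶠ s in 𝓝 t, γ s ∈ K) {w : PhaseSpace n}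
    (hw : charLength K w ≤ omega (γ t) w) : omega y w = 0 := by
  have h1 : HasDerivAt (fun s => omegaL.flip w (γ s)) (omegaL.flip w y) t :=
    (omegaL.flip w).hasFDerivAt.comp_hasDerivAt t hγ
  have h2 : IsLocalMax (fun s => omegaL.flip w (γ s)) t := by
    filter_upwards [hK] with s hs
    simp only [ContinuousLinearMap.flip_apply, omegaL_apply]
    exact (omega_le_charLength hcomp hs w).trans hw
  simpa using h2.hasDerivAt_eq_zero h1

theorem charLength_sum_smul_le (hcomp : IsCompact K) (hne : K.Nonempty) {z : PhaseSpace n}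
    {k : ℕ} {c : Fin k → ℝ} {w : Fin k → PhaseSpace n} (hc : ∀ i, 0 ≤ c i)
    (hw : ∀ i, charLength K (w i) ≤ omega z (w i)) (s : Finset (Fin k)) :
    charLength K (∑ i ∈ s, c i • w i) ≤ omega z (∑ i ∈ s, c i • w i) := by
  induction s using Finset.cons_induction with
  | empty => simp [omega_zero_right, charLength_zero hcomp hne]
  | cons i s hi ih =>
    rw [Finset.sum_cons, omega_add_right, omega_smul_right]
    refine (charLength_add_le hcomp hne _ _).trans (add_le_add ?_ ih)
    rw [charLength_smul hcomp hne (hc i)]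
    exact mul_le_mul_of_nonneg_left (hw i) (hc i)

/-- On the cone generated by `y` and the `w l`, `charLength K` is bounded by the linear form
$\omega(z,\cdot)$. The pair lies in the kernel of that form, and positivity of all `a l` leaves room
to move both ways inside the cone. -/
theorem exists_flat_pair (hcomp : IsCompact K) (hne : K.Nonempty) {z y : PhaseSpace n}
    (hy : charLength K y = 2) (hzy : omega z y = 2)
    (hperp : ∀ w, charLength K w ≤ omega z w → omega y w = 0)
    {k : ℕ} {a : Fin k → ℝ} {w : Fin k → PhaseSpace n} (ha : ∀ i, 0 < a i)
    (hw : ∀ i, charLength K (w i) ≤ omega z (w i)) (hsum : y = ∑ i, a i • w i) {i j : Fin k}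
    (hij : 0 < omega (w i) (w j)) :
    ∃ p : PhaseSpace n × PhaseSpace n, 0 < omega p.1 p.2 ∧
      ∀ θ > 0, p ∈ almostFlat K z y θ := by
  have hne' : i ≠ j := by
    rintro rfl
    rw [omega_self] at hij
    exact hij.false
  set lam : Fin k → ℝ := fun l => omega z (w l) / 2 with hlam
  -- Half of `y` is spread over the `w l` and half is kept. The bounds by `a i / 2` and `a j / 2`
  -- keep the spread coefficients nonnegative; the two bounds by `1 / 4` do this for the coefficient
  -- `d` of `y`.
  obtain ⟨s, hs0, hsi, hsj, hli, hlj⟩ : ∃ s : ℝ, 0 < s ∧ s ≤ a i / 2 ∧ s ≤ a j / 2 ∧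
      s * |lam i| ≤ 1 / 4 ∧ s * |lam j| ≤ 1 / 4 := by
    have hb : ∀ c : ℝ, ∀ s, 0 < s → s ≤ 1 / (4 * (|c| + 1)) → s * |c| ≤ 1 / 4 := by
      intro c s hs h
      rw [le_div_iff₀ (by positivity)] at h
      linarith
    set s := min (min (a i / 2) (a j / 2))
      (min (1 / (4 * (|lam i| + 1))) (1 / (4 * (|lam j| + 1))))
    have hs0 : 0 < s := lt_min (lt_min (half_pos (ha i)) (half_pos (ha j)))
      (lt_min (by positivity) (by positivity))
    exact ⟨s, hs0, (min_le_left _ _).trans (min_le_left _ _),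
      (min_le_left _ _).trans (min_le_right _ _),
      hb _ _ hs0 ((min_le_right _ _).trans (min_le_left _ _)),
      hb _ _ hs0 ((min_le_right _ _).trans (min_le_right _ _))⟩
  set u := s • (w i - lam i • y) with hu
  set v := s • (w j - lam j • y) with hv
  have hzu : omega z u = 0 := by
    rw [hu, omega_smul_right, omega_sub_right, omega_smul_right, hzy, hlam]
    ring
  have hzv : omega z v = 0 := by
    rw [hv, omega_smul_right, omega_sub_right, omega_smul_right, hzy, hlam]
    ring
  have huv : omega u v = s ^ 2 * omega (w i) (w j) := by
    simp only [hu, hv, omega_smul_left, omega_smul_right, omega_sub_left, omega_sub_right,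
      omega_self, hperp _ (hw j), omega_swap y (w i), hperp _ (hw i)]
    ring
  have key : ∀ σ τ : ℝ, |σ| ≤ 1 → |τ| ≤ 1 → charLength K (y + σ • u + τ • v) ≤ 2 := by
    intro σ τ hσ hτ
    set c : Fin k → ℝ := fun l =>
      a l / 2 + (if l = i then σ * s else 0) + (if l = j then τ * s else 0) with hc
    have hσs : |σ * s| ≤ s := by
      rw [abs_mul, abs_of_pos hs0]
      exact mul_le_of_le_one_left hs0.le hσ
    have hτs : |τ * s| ≤ s := by
      rw [abs_mul, abs_of_pos hs0]
      exact mul_le_of_le_one_left hs0.le hτ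
    have hc0 : ∀ l, 0 ≤ c l := by
      intro l
      have := ha l
      have e1 := (abs_le.1 hσs).1
      have e2 := (abs_le.1 hτs).1
      simp only [hc]
      by_cases hli : l = i
      · subst hli
        rw [if_pos rfl, if_neg hne']
        linarith
      · rw [if_neg hli]
        by_cases hlj : l = j
        · subst hlj
          rw [if_pos rfl]
          linarith
        · rw [if_neg hlj]
          linarith
    have hcsum : ∑ l, c l • w l = (1 / 2 : ℝ) • y + (σ * s) • w i + (τ * s) • w j := by
      rw [hsum, Finset.smul_sum]
      simp only [hc, add_smul, Finset.sum_add_distrib, ite_smul, zero_smul, Finset.sum_ite_eq',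
        Finset.mem_univ, if_true, smul_smul]
      congr 3
      ext1 l
      congr 1
      ring
    set d := 1 / 2 - σ * s * lam i - τ * s * lam j with hd
    have hd0 : 0 ≤ d := by
      have e1 : |σ * s * lam i| ≤ 1 / 4 := by
        rw [abs_mul]
        exact (mul_le_mul_of_nonneg_right hσs (abs_nonneg _)).trans hli
      have e2 : |τ * s * lam j| ≤ 1 / 4 := by
        rw [abs_mul]
        exact (mul_le_mul_of_nonneg_right hτs (abs_nonneg _)).trans hlj
      linarith [(abs_le.1 e1).2, (abs_le.1 e2).2]
    have hdecomp : y + σ • u + τ • v = d • y + ∑ l, c l • w l := by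
      rw [hcsum, hu, hv, hd]
      module
    have h1 : omega z (y + σ • u + τ • v) = 2 := by
      rw [omega_add_right, omega_add_right, omega_smul_right σ z u, omega_smul_right τ z v, hzu, hzv,
        hzy]
      ring
    rw [← h1, hdecomp, omega_add_right, omega_smul_right]
    refine (charLength_add_le hcomp hne _ _).trans
      (add_le_add ?_ (charLength_sum_smul_le hcomp hne hc0 hw _))
    rw [charLength_smul hcomp hne hd0, hy, hzy]
  have h1 : |(1 : ℝ)| ≤ 1 := by simp
  have h2 : |(-1 : ℝ)| ≤ 1 := by simp
  refine ⟨(u, v), ?_, fun θ hθ => ⟨⟨?_, ?_⟩, ⟨?_, ?_⟩, ?_, ?_⟩⟩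
  · simp only [huv]
    positivity
  · simpa [hzu] using hθ
  · simpa [hzv] using hθ
  · have := key 1 1 h1 h1
    simp only [one_smul] at this
    exact this.trans_lt (by linarith)
  · have := key 1 (-1) h1 h2
    simp only [one_smul, neg_smul, ← sub_eq_add_neg] at this
    exact this.trans_lt (by linarith)
  · have := key (-1) 1 h2 h1
    simp only [one_smul, neg_smul, ← sub_eq_add_neg] at this
    exact this.trans_lt (by linarith)
  · have := key (-1) (-1) h2 h2
    simp only [neg_smul, one_smul, ← sub_eq_add_neg] at this
    exact this.trans_lt (by linarith)

theorem ae_hasDerivAt_of_absolutelyContinuous {γ : ℝ → PhaseSpace n}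
    (hγ : AbsolutelyContinuousOnInterval γ 0 T) :
    ∀ᵐ t, t ∈ uIcc 0 T → HasDerivAt γ (deriv γ t) t := by
  filter_upwards [hγ.boundedVariationOn.ae_differentiableAt_of_mem_uIcc] with t ht htI
  exact (ht htI).hasDerivAt

theorem absolutelyContinuous_coord {γ : ℝ → PhaseSpace n}
    (hγ : AbsolutelyContinuousOnInterval γ 0 T) (i : Fin n ⊕ Fin n) :
    AbsolutelyContinuousOnInterval (fun t => γ t i) 0 T := by
  refine squeeze_zero (fun _ => Finset.sum_nonneg fun _ _ => dist_nonneg)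
    (fun _ => Finset.sum_le_sum fun _ _ => ?_) hγ
  rw [dist_eq_norm, dist_eq_norm]
  exact PiLp.norm_apply_le (γ _ - γ _) i

theorem eq_add_prim_deriv {γ : ℝ → PhaseSpace n}
    (hγ : AbsolutelyContinuousOnInterval γ 0 T) (hi : IntervalIntegrable (deriv γ) volume 0 T)
    {t : ℝ} (ht : t ∈ uIcc 0 T) : γ t = γ 0 + prim (deriv γ) t := by
  ext i
  have hsub : uIcc 0 t ⊆ uIcc 0 T := uIcc_subset_uIcc left_mem_uIcc ht
  have h1 := ((absolutelyContinuous_coord hγ i).mono hsub).integral_deriv_eq_sub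
  rw [PiLp.add_apply, prim_coord hi ht, ← sub_eq_iff_eq_add', ← h1]
  refine intervalIntegral.integral_congr_ae ?_
  filter_upwards [ae_hasDerivAt_of_absolutelyContinuous hγ] with s hs hst
  exact ((EuclideanSpace.proj (𝕜 := ℝ) i).hasFDerivAt.comp_hasDerivAt s
    (hs (hsub (uIoc_subset_uIcc hst)))).deriv

/-- The flat pair varies with $t$ in an uncountable set. Covering by balls with centres in a dense
sequence and radii `1 / (M + 1)` reduces to countably many sets, none of which can have a density
point with positive gain. -/
theorem ae_not_exists_flat_pair (hT : 0 < T) (hcomp : IsCompact K)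
    (h0 : (0 : PhaseSpace n) ∈ K)
    (hiso : ∀ y : ℝ → PhaseSpace n, MemLp y 2 (volume.restrict (Ioc 0 T)) → prim y T = 0 →
      2 * area T y y ≤ ∫ t in Ioc 0 T, charLength K (y t) ^ 2)
    {x : ℝ → PhaseSpace n} (hxm : Measurable x) (hx : MemLp x 2 (volume.restrict (Ioc 0 T)))
    (hx0 : prim x T = 0) (harea : area T x x = 2 * T)
    (hlen : ∀ᵐ t ∂volume.restrict (Ioc 0 T), charLength K (x t) = 2) {b : PhaseSpace n}
    (hg : Measurable fun t => b + prim x t) :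
    ∀ᵐ t, t ∈ Ioo 0 T → ¬∃ p : PhaseSpace n × PhaseSpace n, 0 < omega p.1 p.2 ∧
      ∀ θ > 0, p ∈ almostFlat K (b + prim x t) (x t) θ := by
  obtain ⟨κ, hκ0, hκ⟩ := exists_profile (PhaseSpace n)
  have hne : K.Nonempty := ⟨0, h0⟩
  have hdr := TopologicalSpace.denseRange_denseSeq (PhaseSpace n × PhaseSpace n)
  set Q := TopologicalSpace.denseSeq (PhaseSpace n × PhaseSpace n)
  let E : ℕ → ℕ → Set ℝ := fun k M => ⋂ m : ℕ, ⋃ j : ℕ,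
    {t | Q j ∈ Metric.ball (Q k) (1 / ((M : ℝ) + 1)) ∧
      Q j ∈ almostFlat K (b + prim x t) (x t) (1 / ((m : ℝ) + 1))}
  have hE : ∀ k M, MeasurableSet (E k M) := fun k M =>
    MeasurableSet.iInter fun m => MeasurableSet.iUnion fun j =>
      (MeasurableSet.const _).inter (measurableSet_mem_almostFlat hcomp hne hg hxm _ _)
  filter_upwards [ae_all_iff.2 fun k => ae_all_iff.2 fun M => ae_exists_dense_interval (hE k M)]
    with t ht htT
  rintro ⟨p, hp, hflat⟩
  -- The gain minus the freezing error, as a function of radius and centre. It is positive at radius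
  -- zero and centre `p`, hence at nearby radii and centres.
  let F : ℝ × (PhaseSpace n × PhaseSpace n) → ℝ := fun z => 2 * κ * omega z.2.1 z.2.2 -
    3 * z.1 * (2 * (‖z.2.1‖ + ‖z.2.2‖) + 2 * z.1)
  have hFc : Continuous F := by
    have : Continuous fun z : ℝ × (PhaseSpace n × PhaseSpace n) => omega z.2.1 z.2.2 :=
      (continuous_fst.comp continuous_snd).omega (continuous_snd.comp continuous_snd)
    fun_prop
  have hF0 : 0 < F (0, p) := by
    simp only [F, mul_zero, zero_mul, sub_zero]
    positivity
  have hF : ∀ᶠ z in 𝓝 ((0 : ℝ), p), 0 < F z ∧ 0 < omega z.2.1 z.2.2 := by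
    refine (hFc.continuousAt.eventually (lt_mem_nhds hF0)).and ?_
    exact ((continuous_fst.comp continuous_snd).omega
      (continuous_snd.comp continuous_snd)).continuousAt.eventually (lt_mem_nhds hp)
  obtain ⟨δ, hδ, hδF⟩ := Metric.eventually_nhds_iff.1 hF
  obtain ⟨M, hM⟩ := exists_nat_one_div_lt hδ
  set η : ℝ := 1 / ((M : ℝ) + 1) with hη
  have hη0 : 0 < η := by positivity
  obtain ⟨k, hk⟩ := hdr.exists_dist_lt p hη0
  have hz := @hδF (η, Q k) (by
    rw [Prod.dist_eq, Real.dist_eq, sub_zero, abs_of_pos hη0, dist_comm]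
    exact max_lt hM (hk.trans hM))
  obtain ⟨hR, hω⟩ := hz
  have htE : t ∈ E k M := by
    refine mem_iInter.2 fun m => mem_iUnion.2 ?_
    obtain ⟨_, hj, j, rfl⟩ := hdr.inter_open_nonempty _
      ((Metric.isOpen_ball (x := Q k) (ε := η)).inter (isOpen_almostFlat hcomp hne
        (b + prim x t) (x t) (1 / ((m : ℝ) + 1)))) ⟨p, hk, hflat _ (by positivity)⟩
    exact ⟨j, hj⟩
  set S := ‖(Q k).1‖ + ‖(Q k).2‖
  have hS : 0 ≤ S := by positivity
  -- This density makes the missing measure times `S` at most `(β - α) * η`.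
  obtain ⟨α, β, hα, hαβ, hβ, hdens⟩ := ht k M htE 0 T htT (η / (S + 1)) (by positivity)
  refine absurd (not_dense_almostFlat hT hcomp h0 hiso hxm hx hx0 harea hlen hg hκ hω.le hη0
    (sub_pos.1 hR) (hE k M) (fun t ht m => ?_) hα hαβ hβ) (not_lt.2 ?_)
  · obtain ⟨j, hj⟩ := mem_iUnion.1 (mem_iInter.1 ht m)
    exact ⟨Q j, hj⟩
  · refine (mul_le_mul_of_nonneg_right hdens hS).trans ?_
    rw [div_mul_eq_mul_div, div_mul_eq_mul_div, div_le_iff₀ (by positivity)]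
    nlinarith [mul_pos hη0 (sub_pos.2 hαβ)]

end CharDyn

/-! ### Conclusion for systolic characteristics. -/

theorem mainTheorem5 (n : ℕ) (K : Set (CharDyn.PhaseSpace n)) (hconv : Convex ℝ K)
    (hcomp : IsCompact K) (h0 : (0 : CharDyn.PhaseSpace n) ∈ interior K)
    (γ : ℝ → CharDyn.PhaseSpace n) (hγ : γ ∈ CharDyn.Sys K) :
    ∀ᵐ t ∂(volume.restrict (Icc 0 (CharDyn.cEHZ K))),
      ∀ (k : ℕ) (a : Fin k → ℝ) (w : Fin k → CharDyn.PhaseSpace n),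
        (∀ i, 0 < a i) →
        (∀ i, w i ∈ CharDyn.J '' CharDyn.normalCone K (γ t)) →
        deriv γ t = ∑ i, a i • w i →
        ∀ i j, CharDyn.omega (w i) (w j) = 0 := by
  open CharDyn in
  obtain ⟨hchar, hact, hnorm⟩ := hγ
  have h0K := interior_subset h0
  have hne : K.Nonempty := ⟨0, h0K⟩
  set T := cEHZ K with hTdef
  have hT := hchar.period_pos
  -- Cutting off outside the period makes the velocity integrable on the line, so its primitive is
  -- continuous and hence measurable everywhere.
  set x : ℝ → PhaseSpace n := (Icc 0 T).indicator (deriv γ) with hxdef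
  have hderivLp := hchar.memLp_deriv
  have hxm : Measurable x := (measurable_deriv γ).indicator measurableSet_Icc
  have hxae : deriv γ =ᵐ[volume.restrict (Ioc 0 T)] x := by
    filter_upwards [ae_restrict_mem measurableSet_Ioc] with t ht
    rw [hxdef, indicator_of_mem (Ioc_subset_Icc_self ht)]
  have hdi : IntervalIntegrable (deriv γ) volume 0 T :=
    memLp_intervalIntegrable hT.le (by rwa [restrict_Icc_eq] at hderivLp)
  have hx : MemLp x 2 (volume.restrict (Ioc 0 T)) := by
    rw [restrict_Icc_eq] at hderivLp
    exact hderivLp.ae_eq hxae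
  have hxint : Integrable x volume :=
    (integrable_indicator_iff measurableSet_Icc).2 (hderivLp.integrable one_le_two)
  have hg : Measurable fun t => γ 0 + prim x t :=
    (continuous_const.add
      (intervalIntegral.continuous_primitive (fun _ _ => hxint.intervalIntegrable) 0)).measurable
  have hγg : ∀ t ∈ Icc 0 T, γ t = γ 0 + prim x t := by
    intro t ht
    rw [eq_add_prim_deriv hchar.absolutelyContinuous hdi (by rwa [uIcc_of_le hT.le]),
      prim_congr_ae hxae ht]
  have hx0 : prim x T = 0 := by
    have := hγg T ⟨hT.le, le_rfl⟩
    rwa [← hchar.closed, left_eq_add] at this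
  have hiso : ∀ y : ℝ → PhaseSpace n, MemLp y 2 (volume.restrict (Ioc 0 T)) → prim y T = 0 →
      2 * area T y y ≤ ∫ t in Ioc 0 T, charLength K (y t) ^ 2 := by
    intro y hy hy0
    have := two_mul_cEHZ_mul_area_le hT hconv hcomp h0 hy hy0
    rw [← hTdef, mul_comm 2 T, mul_assoc] at this
    -- The period equals the capacity, so the factor `T` cancels.
    exact le_of_mul_le_mul_left this hT
  have harea : area T x x = 2 * T := by
    have ix := memLp_intervalIntegrable hT.le hx
    have h1 := integral_omega_add_prim (γ 0) ix ix
    rw [hx0, omega_zero_right, zero_add] at h1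
    have h2 : ∫ t in (0 : ℝ)..T, omega (γ t) (deriv γ t) =
        ∫ t in (0 : ℝ)..T, omega (γ 0 + prim x t) (x t) := by
      refine intervalIntegral.integral_congr fun t ht => ?_
      rw [uIcc_of_le hT.le] at ht
      have hxt : x t = deriv γ t := indicator_of_mem ht _
      change omega (γ t) (deriv γ t) = omega (γ 0 + prim x t) (x t)
      rw [hxt, ← hγg t ht]
    rw [action, h2, h1] at hact
    linarith
  have hlen : ∀ᵐ t ∂volume.restrict (Ioc 0 T), charLength K (x t) = 2 := by
    rw [restrict_Icc_eq] at hnorm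
    filter_upwards [hnorm, hxae] with t h1 h2
    rw [← h2]
    exact h1
  have hdm := hchar.deriv_mem
  rw [restrict_Icc_eq] at hdm ⊢
  have hneT : ∀ᵐ t : ℝ, t ≠ T := by simp [ae_iff, measure_singleton]
  filter_upwards [hlen, hdm, hxae, ae_restrict_mem measurableSet_Ioc,
    ae_restrict_of_ae (ae_not_exists_flat_pair hT hcomp h0K hiso hxm hx hx0 harea hlen hg),
    ae_restrict_of_ae (ae_hasDerivAt_of_absolutelyContinuous hchar.absolutelyContinuous),
    ae_restrict_of_ae hneT] with t hlt hdt hxt htI hnot hd htT k a w ha hw hsum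
  have htIoo : t ∈ Ioo 0 T := ⟨htI.1, lt_of_le_of_ne htI.2 htT⟩
  have htIcc := Ioc_subset_Icc_self htI
  rw [← hγg t htIcc, ← hxt] at hnot
  rw [← hxt] at hlt
  have hmemK : ∀ s ∈ Icc 0 T, γ s ∈ K := fun s hs =>
    hcomp.isClosed.frontier_subset (hchar.mem_boundary s hs)
  have hzy : omega (γ t) (deriv γ t) = 2 :=
    le_antisymm (hlt ▸ omega_le_charLength hcomp (hmemK t htIcc) _)
      (hlt ▸ (neg_J_mem_normalCone_iff hcomp hne _ _).1 hdt)
  have hperp : ∀ v, charLength K v ≤ omega (γ t) v → omega (deriv γ t) v = 0 := fun v hv =>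
    omega_eq_zero_of_hasDerivAt hcomp (hd (by rwa [uIcc_of_le hT.le]))
      (Filter.mem_of_superset (Icc_mem_nhds htIoo.1 htIoo.2) hmemK) hv
  have hw' : ∀ i, charLength K (w i) ≤ omega (γ t) (w i) := by
    intro i
    obtain ⟨v, hv, hvw⟩ := hw i
    rw [← neg_J_mem_normalCone_iff hcomp hne, ← hvw, J_J, neg_neg]
    exact hv
  -- Excluding positive values suffices, since exchanging `i` and `j` changes the sign.
  have hle : ∀ i j, omega (w i) (w j) ≤ 0 := by
    intro i j
    by_contra! hpos
    exact hnot htIoo (exists_flat_pair hcomp hne hlt hzy hperp ha hw' hsum hpos)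
  intro i j
  refine le_antisymm (hle i j) ?_
  have := hle j i
  rw [omega_swap (w i) (w j)] at this
  linarith
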